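/- Identify $(x,y,z)\in\mathbb{R}^3$ with Cartesian coordinates and let $\mathbb{H}$ denote the quaternions with units $\mathbf i,\mathbf j,\mathbf k$. For a differentiable function $h\colon U\to\mathbb{H}$ on an open set $U\subset\mathbb{R}^3$ put \[ Dh=\frac{\partial h}{\partial x}+\mathbf i\,\frac{\partial h}{\partial y}+\mathbf j\,\frac{\partial h}{\partial z},\qquad hD=\frac{\partial h}{\partial x}+\frac{\partial h}{\partial y}\,\mathbf i+\frac{\partial h}{\partial z}\,\mathbf j ; \] $h$ is called left-monogenic in $U$ if $Dh=0$ in $U$, and right-monogenic in $U$ if $hD=0$ in $U$. A compact set $\Omega\subset\mathbb{R}^3$ is called a regular domain if its boundary $\partial\Omega$ has finite area (two-dimensional Hausdorff measure) and $\Omega$ has an outward unit normal at almost every point of $\partial\Omega$ with respect to area. Here $\Omega$ has the outward unit normal $n$ at $p$ if there are an open neighbourhood $U$ of $p$ and a $C^1$ function $\varphi\colon U\to\mathbb{R}$ with $\varphi(p)=0$, $\nabla\varphi(p)\neq0$, $\Omega\cap U=\{x\in U:\varphi(x)\le 0\}$ and $n=\nabla\varphi(p)/|\nabla\varphi(p)|$.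 In particular, every compact set with piecewise smooth boundary that lies locally on one side of its smooth boundary pieces is a regular domain. The boundary is oriented by the outward normal (outward normal first), and \[ d\sigma=dy\wedge dz-\mathbf i\,dx\wedge dz+\mathbf j\,dx\wedge dy . \] The integral over $\partial\Omega$ of an expression $g\,d\sigma f$ is the integral with respect to area of $g(p)\,d\sigma(t_1,t_2)\,f(p)$, where $(t_1,t_2)$ is a positively oriented orthonormal basis of the tangent plane of $\partial\Omega$ at $p$. \textbf{Proposition.} Let $\Omega$ be a regular domain and let $f,g\colon\Omega\to\mathbb{H}$ be continuous functions such that, in the interior $\Omega^\circ$, the function $g$ is (differentiable and) right-monogenic and $f$ is (differentiable and) left-monogenic. Then $g\,d\sigma f$ is integrable over $\partial\Omega$ and \[ \int_{\partial\Omega} g\,d\sigma f=0 . \] -/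

import Mathlib

open scoped Quaternion MeasureTheory

namespace QuatCauchy

/-- Euclidean three-space, with coordinates `(x, y, z) = (p 0, p 1, p 2)`. -/
abbrev R3 : Type := EuclideanSpace ℝ (Fin 3)

/-- The quaternion unit `i`. -/
def qi : ℍ := ⟨0, 1, 0, 0⟩

/-- The quaternion unit `j`. -/
def qj : ℍ := ⟨0, 0, 1, 0⟩

/-- The partial derivative of `f` at `p` in the `m`-th coordinate direction. -/
noncomputable def partialDeriv (m : Fin 3) (f : R3 → ℍ) (p : R3) : ℍ :=
  fderiv ℝ f p (EuclideanSpace.single m (1 : ℝ))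

/-- The generalized Cauchy-Riemann operator acting from the left:
`D f = ∂f/∂x + i ∂f/∂y + j ∂f/∂z`. -/
noncomputable def leftD (f : R3 → ℍ) (p : R3) : ℍ :=
  partialDeriv 0 f p + qi * partialDeriv 1 f p + qj * partialDeriv 2 f p

/-- The generalized Cauchy-Riemann operator acting from the right:
`g D = ∂g/∂x + ∂g/∂y i + ∂g/∂z j`. -/
noncomputable def rightD (g : R3 → ℍ) (p : R3) : ℍ :=
  partialDeriv 0 g p + partialDeriv 1 g p * qi + partialDeriv 2 g p * qj

/-- `f` is left-monogenic in the open set `U`: differentiable with `D f = 0`. -/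
def LeftMonogenicOn (f : R3 → ℍ) (U : Set R3) : Prop :=
  DifferentiableOn ℝ f U ∧ ∀ p ∈ U, leftD f p = 0

/-- `g` is right-monogenic in the open set `U`: differentiable with `g D = 0`. -/
def RightMonogenicOn (g : R3 → ℍ) (U : Set R3) : Prop :=
  DifferentiableOn ℝ g U ∧ ∀ p ∈ U, rightD g p = 0

/-- `n` is the outward unit normal of `Ω` at the boundary point `p`: near `p`, the set `Ω` is a
sublevel set `{φ ≤ 0}` of a continuously differentiable function `φ` with `φ p = 0` and
`∇φ(p) ≠ 0` (so `∂Ω` is a `C¹` surface near `p` and `Ω` lies on one side of it), and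
`n = ∇φ(p) / |∇φ(p)|`. -/
def IsOutwardUnitNormal (Ω : Set R3) (p n : R3) : Prop :=
  ∃ (U : Set R3) (φ : R3 → ℝ), IsOpen U ∧ p ∈ U ∧ ContDiffOn ℝ 1 φ U ∧ φ p = 0 ∧
    gradient φ p ≠ 0 ∧ Ω ∩ U = {x ∈ U | φ x ≤ 0} ∧ n = ‖gradient φ p‖⁻¹ • gradient φ p

/-- A regular domain: a compact set whose boundary has finite area and possesses an outward unit
normal almost everywhere with respect to area. The measure `μHE[2]` is the two-dimensional
Hausdorff measure, normalized to be the usual surface area. -/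
structure IsRegularDomain (Ω : Set R3) : Prop where
  isCompact : IsCompact Ω
  area_lt_top : μHE[2] (frontier Ω) < ⊤
  ae_normal : μHE[2] {p ∈ frontier Ω | ¬ ∃ n, IsOutwardUnitNormal Ω p n} = 0

/-- The value on `(v, w)` of the wedge product `dx_l ∧ dx_m` of two coordinate differentials. -/
def coordWedge (l m : Fin 3) (v w : R3) : ℝ := v l * w m - v m * w l

/-- The value on `(v, w)` of the quaternion-valued two-form
`dσ = dy ∧ dz - i dx ∧ dz + j dx ∧ dy`. -/
noncomputable def dsigma (v w : R3) : ℍ :=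
  (coordWedge 1 2 v w : ℍ) - qi * (coordWedge 0 2 v w : ℍ) + qj * (coordWedge 0 1 v w : ℍ)

/-- `(t 0, t 1)` is an orthonormal basis of the tangent plane of `∂Ω` at `p`, positively oriented
for the boundary orientation (outward normal first). -/
def IsPositiveTangentFrame (Ω : Set R3) (p : R3) (t : Fin 2 → R3) : Prop :=
  ∃ n, IsOutwardUnitNormal Ω p n ∧ Orthonormal ℝ t ∧ (∀ a, inner ℝ n (t a) = 0) ∧
    0 < Matrix.det (Matrix.of fun a b : Fin 3 => (![n, t 0, t 1] a) b)

open Classical in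
/-- The density of the restriction of `dσ` to the oriented surface `∂Ω` with respect to the area
element `dS`: the value of `dσ` on a positively oriented orthonormal tangent frame (it does not
depend on the frame). The value at points without an outward normal is irrelevant. -/
noncomputable def dsigmaDensity (Ω : Set R3) (p : R3) : ℍ :=
  if h : ∃ t, IsPositiveTangentFrame Ω p t then dsigma (h.choose 0) (h.choose 1) else 0

/-- `g dσ f` is absolutely integrable over `∂Ω`. -/
def BoundaryIntegrable (Ω : Set R3) (g f : R3 → ℍ) : Prop :=
  MeasureTheory.IntegrableOn (fun p => g p * dsigmaDensity Ω p * f p) (frontier Ω) μHE[2]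

/-- The surface integral `∫_{∂Ω} g dσ f`. -/
noncomputable def boundaryIntegral (Ω : Set R3) (g f : R3 → ℍ) : ℍ :=
  ∫ p in frontier Ω, g p * dsigmaDensity Ω p * f p ∂μHE[2]

end QuatCauchy

namespace QuatCauchy

/-! Each real component `ℓ (g dσ f)` is the flux of the vector field with coordinates `ℓ (g e_m f)`,
where `e = (1, i, j)`, since `dσ` evaluated on a positive tangent frame is `n₀ + i n₁ + j n₂`
(`IsPositiveTangentFrame.dsigma_eq`). By the Leibniz rule the divergence of this field is `ℓ (g (D
f) + (g D) f)`, which vanishes in the interior (`div_fluxField`). It remains to show that such a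
field `F`, continuous up to the boundary, has zero flux. Two obstacles arise: the derivatives of `F`
need be neither continuous nor integrable, and the boundary is only almost everywhere `C¹`.

The first is removed by passing to the weak formulation: the divergence theorem for merely
differentiable fields, applied to `η F`, gives `∫ Dη(F) = 0` for test functions supported in the
interior (`integral_fderiv_apply_eq_zero`). After that no derivative of `F` appears.

Near a boundary point with a normal, testing with `ψ` times a cutoff of a thin boundary layer
expresses `∫ Dψ(F)` as an average over the layer. A chart that is bi-Lipschitz with constant near
`1` compares the layer with surface area, with error at most `ε ∫ ψ dS`
(`IsOutwardUnitNormal.exists_flux_estimate`). This error is additive in `ψ`, so a partition of unity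
followed by `ε → 0` yields the exact Gauss formula for test functions supported away from the
singular boundary points (`integral_fderiv_eq_flux`).

The singular points form a compact set of zero area, hence of zero `W^{1,1}` capacity: they can be
cut off by functions whose gradients have arbitrarily small `L¹` norm (`exists_cutoff`). As `F` is
bounded on `Ω`, the cutoff changes the flux formula by arbitrarily little (`integral_flux_eq_zero`).
-/

open MeasureTheory Set Filter Topology

/-! ### Pointwise divergence free fields are weakly divergence free -/

/-- A continuous vector field that is differentiable and divergence free in the open set `O`
is weakly divergence free in `O`; no integrability of its derivative is needed. -/
theorem integral_fderiv_apply_eq_zero {O : Set R3} {F : R3 → R3} (hF : Continuous F)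
    (hFd : ∀ x ∈ O, DifferentiableAt ℝ F x)
    (hdiv : ∀ x ∈ O, ∑ i, (fderiv ℝ F x (EuclideanSpace.single i 1)) i = 0)
    {η : R3 → ℝ} (hη : ContDiff ℝ 1 η) (hc : HasCompactSupport η) (hs : tsupport η ⊆ O) :
    ∫ x, fderiv ℝ η x (F x) = 0 := by
  classical
  obtain ⟨R, hR⟩ : ∃ R, ∀ x ∈ tsupport η, ‖x‖ < R := by
    obtain ⟨R, hR⟩ := hc.isCompact.isBounded.exists_norm_le
    exact ⟨R + 1, fun x hx => by linarith [hR x hx]⟩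
  have hR' : ∀ x : R3, R ≤ ‖x‖ → x ∉ tsupport η := fun x hx h => absurd (hR x h) (not_lt.2 hx)
  have hout : ∀ x ∉ tsupport η, HasFDerivAt η (0 : R3 →L[ℝ] ℝ) x := fun x hx => by
    have := notMem_tsupport_iff_eventuallyEq.1 hx
    exact (hasFDerivAt_const (0 : ℝ) x).congr_of_eventuallyEq this
  let L : R3 ≃L[ℝ] (Fin 3 → ℝ) := EuclideanSpace.equiv (Fin 3) ℝ
  -- `F` is differentiable only on `O`, so the product formula is used on the support of `η`;
  -- elsewhere `η F` vanishes locally and its derivative is `0`.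
  let D : Fin 3 → R3 → (R3 →L[ℝ] ℝ) := fun i x =>
    if x ∈ tsupport η then
      η x • ((EuclideanSpace.proj i).comp (fderiv ℝ F x)) + (F x i) • fderiv ℝ η x else 0
  have hD : ∀ x i, HasFDerivAt (fun x => η x * F x i) (D i x) x := by
    intro x i
    by_cases hx : x ∈ tsupport η
    · simp only [D, if_pos hx]
      have h1 : HasFDerivAt (fun x => F x i) ((EuclideanSpace.proj i).comp (fderiv ℝ F x)) x :=
        (EuclideanSpace.proj i : R3 →L[ℝ] ℝ).hasFDerivAt.comp x (hFd x (hs hx)).hasFDerivAt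
      exact ((hη.differentiable one_ne_zero) x).hasFDerivAt.mul h1
    · simp only [D, if_neg hx]
      have := notMem_tsupport_iff_eventuallyEq.1 hx
      refine (hasFDerivAt_const (0 : ℝ) x).congr_of_eventuallyEq ?_
      filter_upwards [this] with y hy
      simp [hy]
  have hsum : ∀ x, ∑ i, D i x (EuclideanSpace.single i 1) = fderiv ℝ η x (F x) := by
    intro x
    by_cases hx : x ∈ tsupport η
    · have h2 : fderiv ℝ η x (F x) = ∑ i, F x i * fderiv ℝ η x (EuclideanSpace.single i 1) := by
        conv_lhs => rw [← (EuclideanSpace.basisFun (Fin 3) ℝ).sum_repr (F x)]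
        simp [map_sum]
      simp only [D, if_pos hx, add_apply, smul_apply,
        ContinuousLinearMap.comp_apply, Finset.sum_add_distrib, smul_eq_mul, ← Finset.mul_sum]
      rw [h2]
      have := hdiv x (hs hx)
      change η x * (∑ i, (fderiv ℝ F x (EuclideanSpace.single i 1)) i) + _ = _
      rw [this, mul_zero, zero_add]
    · simp [D, if_neg hx, (hout x hx).fderiv]
  have hcont : Continuous fun x => fderiv ℝ η x (F x) :=
    (hη.continuous_fderiv one_ne_zero).clm_apply hF
  have hnorm : ∀ (y : Fin 3 → ℝ) (i : Fin 3), |y i| ≤ ‖(L.symm y : R3)‖ := fun y i => by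
    exact PiLp.norm_apply_le (L.symm y : R3) i
  rcases lt_or_ge R 0 with hneg | hR0
  · have : ∀ x, fderiv ℝ η x (F x) = 0 := fun x => by
      rw [(hout x (hR' x (by linarith [norm_nonneg x]))).fderiv]; simp
    simp [this]
  have hle : (fun _ => -R : Fin 3 → ℝ) ≤ fun _ => R := fun _ => by simp; linarith
  -- This divergence theorem asks only for integrability of the total divergence of `η F`. By `hsum`
  -- that is `Dη(F)`, which is continuous, although the separate partial derivatives may not be
  -- integrable.
  have key := integral_divergence_of_hasFDerivAt_off_countable' (fun _ => -R) (fun _ => R) hle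
    (fun i y => η (L.symm y) * F (L.symm y) i)
    (fun i y => (D i (L.symm y)).comp (L.symm : (Fin 3 → ℝ) →L[ℝ] R3)) ∅ countable_empty
    (fun i => by
      have := hη.continuous
      have : Continuous fun x : R3 => η x * F x i := by fun_prop
      exact (this.comp L.symm.continuous).continuousOn)
    (fun y _ i => (hD (L.symm y) i).comp y L.symm.hasFDerivAt)
  have hLs : ∀ i, L.symm (Pi.single i 1) = EuclideanSpace.single i 1 := fun i => rfl
  simp only [ContinuousLinearMap.comp_apply, ContinuousLinearEquiv.coe_coe, hLs, hsum] at key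
  have hvol := (PiLp.volume_preserving_toLp (Fin 3)).integral_comp
    (MeasurableEquiv.toLp 2 (Fin 3 → ℝ)).measurableEmbedding (fun x : R3 => fderiv ℝ η x (F x))
  rw [← hvol]
  rw [setIntegral_eq_integral_of_forall_compl_eq_zero] at key
  · refine (key ((hcont.comp L.symm.continuous).continuousOn.integrableOn_compact
      isCompact_Icc)).trans ?_
    refine Finset.sum_eq_zero fun i _ => ?_
    have hz : ∀ (t : ℝ) (z : Fin 2 → ℝ), |t| = R → η (L.symm (i.insertNth t z)) = 0 := by
      intro t z ht
      refine image_eq_zero_of_notMem_tsupport (hR' _ ?_)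
      simpa [ht] using hnorm (i.insertNth t z) i
    simp [hz, abs_of_nonneg hR0]
  · intro y hy
    have : ∃ i, R < |y i| := by
      by_contra! h
      exact hy ⟨fun i => (abs_le.1 (h i)).1, fun i => (abs_le.1 (h i)).2⟩
    obtain ⟨i, hi⟩ := this
    rw [(hout _ (hR' _ (hi.le.trans (hnorm y i)))).fderiv]; simp

/-! ### Hausdorff measure and integrals under bi-Lipschitz maps -/

section Comparison

variable {X Y : Type*} [MetricSpace X] [MeasurableSpace X] [BorelSpace X]
  [MetricSpace Y] [MeasurableSpace Y] [BorelSpace Y]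

theorem euclideanHausdorffMeasure_image_le {K : NNReal} {f : X → Y} {s : Set X}
    (h : LipschitzOnWith K f s) (d : ℕ) : μHE[d] (f '' s) ≤ (K : ENNReal) ^ d * μHE[d] s := by
  simp only [Measure.euclideanHausdorffMeasure_def, Measure.smul_apply, ENNReal.smul_def,
    smul_eq_mul]
  have := h.hausdorffMeasure_image_le (Nat.cast_nonneg d)
  rw [ENNReal.rpow_natCast] at this
  calc _ ≤ _ := mul_le_mul_right this _
    _ = _ := by ring

/-- Under a bi-Lipschitz bijection `f : A → B` with constant `K`, integrals with respect to the
`d`-dimensional measure change at most by the factor `K ^ d`. -/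
theorem integral_biLipschitz_le {K : NNReal} {f : X → Y} {A : Set X} {B : Set Y}
    (hA : MeasurableSet A) (hAB : f '' A = B)
    (hl : LipschitzOnWith K f A)
    (ha : ∀ x ∈ A, ∀ y ∈ A, dist x y ≤ K * dist (f x) (f y)) (d : ℕ)
    {G : Y → ℝ} (hG0 : ∀ y, 0 ≤ G y) (hG : IntegrableOn G B μHE[d]) :
    ∫ x in A, G (f x) ∂μHE[d] ≤ (K : ℝ) ^ d * ∫ y in B, G y ∂μHE[d] ∧
    ∫ y in B, G y ∂μHE[d] ≤ (K : ℝ) ^ d * ∫ x in A, G (f x) ∂μHE[d] := by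
  have hf : AEMeasurable f ((μHE[d] : Measure X).restrict A) :=
    hl.continuousOn.aemeasurable hA
  have hmaps : MapsTo f A B := fun x hx => hAB ▸ mem_image_of_mem f hx
  have hinj : InjOn f A := fun x hx y hy h => by
    have := ha x hx y hy
    rw [h, dist_self, mul_zero] at this
    exact dist_le_zero.1 this
  have h1 : ((μHE[d] : Measure X).restrict A).map f ≤
      ((K : ENNReal) ^ d) • (μHE[d] : Measure Y).restrict B := by
    refine Measure.le_iff.2 fun T hT => ?_
    rw [Measure.map_apply_of_aemeasurable hf hT, Measure.restrict_apply' hA, Measure.smul_apply,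
      Measure.restrict_apply hT, smul_eq_mul]
    rcases A.eq_empty_or_nonempty with rfl | ⟨a0, ha0⟩
    · simp
    have : Nonempty X := ⟨a0⟩
    have hinv : LipschitzOnWith K (Function.invFunOn f A) (T ∩ B) := by
      refine LipschitzOnWith.of_dist_le_mul ?_
      rintro _ ⟨-, hy⟩ _ ⟨-, hz⟩
      rw [← hAB] at hy hz
      obtain ⟨x, hx, rfl⟩ := hy
      obtain ⟨x', hx', rfl⟩ := hz
      rw [hinj.leftInvOn_invFunOn hx, hinj.leftInvOn_invFunOn hx']
      exact ha x hx x' hx'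
    refine le_trans (measure_mono ?_) (euclideanHausdorffMeasure_image_le hinv d)
    rintro x ⟨hxT, hxA⟩
    exact ⟨f x, ⟨hxT, hmaps hxA⟩, hinj.leftInvOn_invFunOn hxA⟩
  have h2 : (μHE[d] : Measure Y).restrict B ≤
      ((K : ENNReal) ^ d) • ((μHE[d] : Measure X).restrict A).map f := by
    refine Measure.le_iff.2 fun T hT => ?_
    rw [Measure.smul_apply, Measure.map_apply_of_aemeasurable hf hT, Measure.restrict_apply' hA,
      Measure.restrict_apply hT, smul_eq_mul]
    refine le_trans (measure_mono ?_)
      (euclideanHausdorffMeasure_image_le (hl.mono inter_subset_right) d)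
    rintro y ⟨hyT, hyB⟩
    rw [← hAB] at hyB
    obtain ⟨x, hx, rfl⟩ := hyB
    exact ⟨x, ⟨hyT, hx⟩, rfl⟩
  have hK : (K : ENNReal) ^ d ≠ ⊤ := by finiteness
  have hGm : Integrable G (((μHE[d] : Measure X).restrict A).map f) :=
    Integrable.of_measure_le_smul hK h1 hG
  have e : ∫ x in A, G (f x) ∂μHE[d] = ∫ y, G y ∂(((μHE[d] : Measure X).restrict A).map f) :=
    (integral_map hf hGm.aestronglyMeasurable).symm
  rw [e]
  have hKr : ((K : ENNReal) ^ d).toReal = (K : ℝ) ^ d := by simp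
  constructor
  · have := integral_mono_measure h1 (ae_of_all _ hG0) (hG.smul_measure hK)
    rwa [integral_smul_measure, hKr, smul_eq_mul] at this
  · have := integral_mono_measure h2 (ae_of_all _ hG0) (hGm.smul_measure hK)
    rwa [integral_smul_measure, hKr, smul_eq_mul] at this

end Comparison

/-! ### Cutoffs around compact sets of zero area -/

/-- Smooth cutoffs of balls of radius `r` in three-space whose gradient has total mass `O(r ^ 2)`. -/
theorem exists_ball_cutoff : ∃ A : ℝ, 0 ≤ A ∧ ∀ (c : R3) (r : ℝ), 0 < r → ∃ β : R3 → ℝ,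
    ContDiff ℝ 1 β ∧ (∀ x, 0 ≤ β x ∧ β x ≤ 1) ∧ (∀ x ∈ Metric.ball c r, β x = 1) ∧
    (∀ x ∉ Metric.ball c (2 * r), β x = 0) ∧ Integrable (fun x => ‖fderiv ℝ β x‖) ∧
    ∫ x, ‖fderiv ℝ β x‖ = A * r ^ 2 := by
  let f : ContDiffBump (0 : R3) := ⟨1, 2, one_pos, one_lt_two⟩
  have hf : ContDiff ℝ 1 f := f.contDiff
  have hint : Integrable (fun x => ‖fderiv ℝ f x‖) :=
    ((hf.continuous_fderiv one_ne_zero).integrable_of_hasCompactSupport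
      (f.hasCompactSupport.fderiv ℝ)).norm
  -- Rescaling the unit bump by `r` multiplies the gradient by `r⁻¹` and the volume by `r ^ 3`,
  -- hence the factor `r ^ 2`.
  refine ⟨∫ x, ‖fderiv ℝ f x‖, integral_nonneg fun _ => norm_nonneg _, fun c r hr => ?_⟩
  have hnorm : ∀ x, ‖r⁻¹ • (x - c)‖ = dist x c / r := fun x => by
    rw [norm_smul, norm_inv, Real.norm_of_nonneg hr.le, dist_eq_norm, div_eq_inv_mul]
  have hfd : ∀ x, ‖fderiv ℝ (fun x => f (r⁻¹ • (x - c))) x‖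
      = r⁻¹ * ‖fderiv ℝ f (r⁻¹ • (x - c))‖ := fun x => by
    have h1 : HasFDerivAt (fun x : R3 => r⁻¹ • (x - c)) (r⁻¹ • ContinuousLinearMap.id ℝ R3) x :=
      ((hasFDerivAt_id x).sub_const c).const_smul r⁻¹
    have h2 := (((hf.differentiable one_ne_zero) (r⁻¹ • (x - c))).hasFDerivAt.comp x h1).fderiv
    rw [show (fun x => f (r⁻¹ • (x - c))) = f ∘ fun x : R3 => r⁻¹ • (x - c) from rfl, h2,
      ContinuousLinearMap.comp_smul, ContinuousLinearMap.comp_id, norm_smul, norm_inv,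
      Real.norm_of_nonneg hr.le]
  refine ⟨fun x => f (r⁻¹ • (x - c)), hf.comp (by fun_prop), fun x => ⟨f.nonneg, f.le_one⟩,
    fun x hx => ?_, fun x hx => ?_, ?_, ?_⟩
  · refine f.one_of_mem_closedBall ?_
    rw [mem_closedBall_zero_iff, hnorm]
    exact ((div_lt_one hr).2 hx).le
  · refine f.zero_of_le_dist ?_
    rw [dist_zero_right, hnorm, le_div_iff₀ hr]
    simpa using hx
  · simp_rw [hfd]
    exact (((hint.comp_smul (inv_ne_zero hr.ne')).comp_sub_right c)).const_mul _
  · simp_rw [hfd]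
    rw [integral_const_mul, integral_sub_right_eq_self (fun x => ‖fderiv ℝ f (r⁻¹ • x)‖) c,
      Measure.integral_comp_inv_smul volume (fun x => ‖fderiv ℝ f x‖)]
    simp [abs_of_pos hr]
    field_simp

/-- In each term of the product rule the undifferentiated factors lie in `[0, 1]`. -/
theorem norm_fderiv_prod_le {ι : Type*} (s : Finset ι) {u : ι → R3 → ℝ}
    (hu : ∀ i ∈ s, ContDiff ℝ 1 (u i)) (h01 : ∀ i ∈ s, ∀ x, 0 ≤ u i x ∧ u i x ≤ 1) (x : R3) :
    ‖fderiv ℝ (fun x => ∏ i ∈ s, u i x) x‖ ≤ ∑ i ∈ s, ‖fderiv ℝ (u i) x‖ := by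
  classical
  rw [fderiv_finsetProd fun i hi => (hu i hi).differentiable one_ne_zero x]
  refine (norm_sum_le _ _).trans (Finset.sum_le_sum fun i hi => ?_)
  rw [norm_smul]
  refine mul_le_of_le_one_left (norm_nonneg _) ?_
  rw [Real.norm_of_nonneg (Finset.prod_nonneg fun j hj => (h01 j (Finset.mem_of_mem_erase hj) x).1)]
  exact Finset.prod_le_one (fun j hj => (h01 j (Finset.mem_of_mem_erase hj) x).1)
    fun j hj => (h01 j (Finset.mem_of_mem_erase hj) x).2

/-- A compact set of zero area can be covered by finitely many balls centred at it, of small radii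
with small sum of squares. -/
theorem exists_finite_ball_cover {E : Set R3} (hE : IsCompact E) (h0 : μHE[2] E = 0)
    {δ ε : ℝ} (hδ : 0 < δ) (hε : 0 < ε) :
    ∃ (s : Finset ℕ) (c : ℕ → R3) (r : ℕ → ℝ), (∀ i ∈ s, c i ∈ E) ∧ (∀ i, 0 < r i ∧ r i < δ) ∧
      E ⊆ ⋃ i ∈ s, Metric.ball (c i) (r i) ∧ ∑ i ∈ s, r i ^ 2 ≤ ε := by
  classical
  have hH : μH[2] E = 0 := by
    rw [Measure.euclideanHausdorffMeasure_def, Measure.smul_apply, ENNReal.smul_def, smul_eq_mul,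
      mul_eq_zero] at h0
    rcases h0 with h0 | h0
    · exact absurd (ENNReal.coe_eq_zero.1 h0)
        (Measure.addHaarScalarFactor_volume_hausdorffMeasure_ne_zero 2)
    · exact_mod_cast h0
  rcases E.eq_empty_or_nonempty with rfl | ⟨e0, he0⟩
  · exact ⟨∅, fun _ => 0, fun _ => δ / 2, by simp, by simp [hδ], by simp, by simp [hε.le]⟩
  rw [Measure.hausdorffMeasure_apply] at hH
  have hδ2 : (0 : ENNReal) < ENNReal.ofReal (δ / 2) := by simp [hδ]
  have h1 := (ENNReal.iSup_eq_zero.1 ((ENNReal.iSup_eq_zero.1 hH) (ENNReal.ofReal (δ / 2))))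
    hδ2
  have hε4 : (0 : ENNReal) < ENNReal.ofReal (ε / 4) := by simp [hε]
  rw [← h1] at hε4
  simp only [iInf_lt_iff] at hε4
  obtain ⟨t, htE, htd, hts⟩ := hε4
  have hdiam : ∀ n, (Metric.ediam (t n)) ≠ ⊤ := fun n => ((htd n).trans_lt ENNReal.ofReal_lt_top).ne
  let D : ℕ → ℝ := fun n => (Metric.ediam (t n)).toReal
  have hD0 : ∀ n, 0 ≤ D n := fun n => ENNReal.toReal_nonneg
  have hDδ : ∀ n, D n ≤ δ / 2 := fun n => ENNReal.toReal_le_of_le_ofReal (by positivity) (htd n)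
  have hDsum : ∀ s : Finset ℕ, ∑ n ∈ s, D n ^ 2 ≤ ε / 4 := fun s => by
    have h2 : ∑ n ∈ s, (Metric.ediam (t n)) ^ 2 ≤ ENNReal.ofReal (ε / 4) := by
      refine le_trans ?_ hts.le
      refine le_trans (Finset.sum_le_sum fun n _ => ?_) (ENNReal.sum_le_tsum s)
      rcases (t n).eq_empty_or_nonempty with h | h
      · simp [h]
      · simp [h]
    have h3 := ENNReal.toReal_le_of_le_ofReal (by positivity) h2
    rw [ENNReal.toReal_sum (fun n _ => ENNReal.pow_ne_top (hdiam n))] at h3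
    simpa [D, ENNReal.toReal_pow] using h3
  -- The diameters are padded by `a / 2 ^ n`, so that the open balls contain the covering sets even
  -- when a diameter is zero. With `(u + v)² ≤ 2u² + 2v²` the sum of squares is at most `2 (ε / 4) +
  -- 4 a² ≤ ε`.
  obtain ⟨a, ha0, haδ, haε⟩ : ∃ a : ℝ, 0 < a ∧ a < δ / 2 ∧ a ^ 2 ≤ ε / 8 := by
    refine ⟨min (δ / 4) (Real.sqrt (ε / 8)), by positivity, ?_, ?_⟩
    · exact (min_le_left _ _).trans_lt (by linarith)
    · calc _ ≤ Real.sqrt (ε / 8) ^ 2 := by gcongr; exact min_le_right _ _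
        _ = _ := Real.sq_sqrt (by positivity)
  let r : ℕ → ℝ := fun n => D n + a * (1 / 2) ^ n
  have hp : ∀ n : ℕ, 0 < ((1 : ℝ) / 2) ^ n ∧ ((1 : ℝ) / 2) ^ n ≤ 1 := fun n =>
    ⟨by positivity, pow_le_one₀ (by norm_num) (by norm_num)⟩
  have hr : ∀ n, 0 < r n ∧ r n < δ := fun n => by
    have := hp n
    refine ⟨add_pos_of_nonneg_of_pos (hD0 n) (mul_pos ha0 this.1), ?_⟩
    have : a * (1 / 2) ^ n ≤ a := mul_le_of_le_one_right ha0.le this.2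
    simp only [r]; linarith [hDδ n]
  have hcen : ∀ n, ∃ c ∈ E, ∀ x ∈ t n ∩ E, x ∈ Metric.ball c (r n) := fun n => by
    rcases (t n ∩ E).eq_empty_or_nonempty with h | ⟨c, hc⟩
    · exact ⟨e0, he0, by simp [h]⟩
    · refine ⟨c, hc.2, fun x hx => ?_⟩
      have h2 : dist x c ≤ D n := by
        rw [dist_edist]
        exact ENNReal.toReal_mono (hdiam n) (Metric.edist_le_ediam_of_mem hx.1 hc.1)
      exact h2.trans_lt (lt_add_of_pos_right _ (mul_pos ha0 (hp n).1))
  choose c hcE hc using hcen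
  obtain ⟨s, hs⟩ := hE.elim_finite_subcover (fun n => Metric.ball (c n) (r n))
    (fun n => Metric.isOpen_ball) (fun x hx => by
      obtain ⟨n, hn⟩ := mem_iUnion.1 (htE hx)
      exact mem_iUnion.2 ⟨n, hc n x ⟨hn, hx⟩⟩)
  refine ⟨s, c, r, fun i _ => hcE i, hr, hs, ?_⟩
  have hgeo : ∑ n ∈ s, ((1 : ℝ) / 2) ^ n ≤ 2 := by
    exact (summable_geometric_two.sum_le_tsum s fun n _ => (hp n).1.le).trans_eq tsum_geometric_two
  calc ∑ n ∈ s, r n ^ 2 ≤ ∑ n ∈ s, (2 * D n ^ 2 + 2 * a ^ 2 * (1 / 2) ^ n) := by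
        refine Finset.sum_le_sum fun n _ => ?_
        have h2 : (((1 : ℝ) / 2) ^ n) ^ 2 ≤ (1 / 2) ^ n := by
          have := hp n; nlinarith
        have h3 : r n ^ 2 ≤ 2 * D n ^ 2 + 2 * (a * (1 / 2) ^ n) ^ 2 := by
          simp only [r]; nlinarith [sq_nonneg (D n - a * (1 / 2) ^ n)]
        rw [mul_pow] at h3
        nlinarith [sq_nonneg a]
    _ = 2 * ∑ n ∈ s, D n ^ 2 + 2 * a ^ 2 * ∑ n ∈ s, (1 / 2) ^ n := by
        rw [Finset.sum_add_distrib, Finset.mul_sum, Finset.mul_sum]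
    _ ≤ 2 * (ε / 4) + 2 * a ^ 2 * 2 := by gcongr; exact hDsum s
    _ ≤ ε := by linarith

/-- A compact set of zero area in three-space has zero `W^{1,1}` capacity. -/
theorem exists_cutoff {E W : Set R3} (hE : IsCompact E) (h0 : μHE[2] E = 0) (hW : IsOpen W)
    (hEW : E ⊆ W) {ε : ℝ} (hε : 0 < ε) :
    ∃ χ : R3 → ℝ, ContDiff ℝ 1 χ ∧ (∀ x, 0 ≤ χ x ∧ χ x ≤ 1) ∧ (∀ x ∈ E, ∀ᶠ y in 𝓝 x, χ y = 1) ∧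
      (∀ x ∉ W, χ x = 0) ∧ Integrable (fun x => ‖fderiv ℝ χ x‖) ∧ ∫ x, ‖fderiv ℝ χ x‖ ≤ ε := by
  obtain ⟨A, hA0, hA⟩ := exists_ball_cutoff
  obtain ⟨δ, hδ, hδW⟩ := hE.exists_thickening_subset_open hW hEW
  -- Radii below `δ / 2` keep the doubled balls, outside which the cutoffs vanish, inside `W`; the
  -- denominator `A + 1` avoids dividing by a possibly zero `A`.
  obtain ⟨s, c, r, hc, hr, hcov, hsum⟩ := exists_finite_ball_cover hE h0 (half_pos hδ)
    (show 0 < ε / (A + 1) by positivity)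
  choose β hβ using fun i => hA (c i) (r i) (hr i).1
  have hu : ∀ i ∈ s, ContDiff ℝ 1 (fun x => 1 - β i x) := fun i _ =>
    contDiff_const.sub (hβ i).1
  have h01 : ∀ i ∈ s, ∀ x, 0 ≤ 1 - β i x ∧ 1 - β i x ≤ 1 := fun i _ x =>
    ⟨by linarith [((hβ i).2.1 x).2], by linarith [((hβ i).2.1 x).1]⟩
  -- The cutoff is `1 - ∏ (1 - β i)`, a smooth substitute for the maximum: it is `1` where some `β
  -- i` is `1`, `0` where all vanish, and its gradient is bounded by the sum of the gradients.
  have hPc : ContDiff ℝ 1 (fun x => ∏ i ∈ s, (1 - β i x)) := contDiff_prod hu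
  have hbd : ∀ x, ‖fderiv ℝ (fun x => 1 - ∏ i ∈ s, (1 - β i x)) x‖ ≤ ∑ i ∈ s, ‖fderiv ℝ (β i) x‖ := by
    intro x
    rw [fderiv_const_sub, norm_neg]
    refine (norm_fderiv_prod_le s hu h01 x).trans_eq (Finset.sum_congr rfl fun i _ => ?_)
    rw [fderiv_const_sub, norm_neg]
  have hIs : Integrable (fun x => ∑ i ∈ s, ‖fderiv ℝ (β i) x‖) :=
    integrable_finsetSum s fun i _ => (hβ i).2.2.2.2.1
  have hCD : ContDiff ℝ 1 (fun x => 1 - ∏ i ∈ s, (1 - β i x)) := contDiff_const.sub hPc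
  have hI : Integrable (fun x => ‖fderiv ℝ (fun x => 1 - ∏ i ∈ s, (1 - β i x)) x‖) :=
    hIs.mono' (hCD.continuous_fderiv one_ne_zero).norm.aestronglyMeasurable
      (ae_of_all _ fun x => by rw [norm_norm]; exact hbd x)
  refine ⟨fun x => 1 - ∏ i ∈ s, (1 - β i x), hCD, fun x => ⟨?_, ?_⟩,
    fun x hx => ?_, fun x hx => ?_, hI, ?_⟩
  · have := Finset.prod_le_one (fun i hi => (h01 i hi x).1) (fun i hi => (h01 i hi x).2)
    linarith
  · have := Finset.prod_nonneg (fun i hi => (h01 i hi x).1)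
    linarith
  · obtain ⟨i, hi, hxi⟩ := mem_iUnion₂.1 (hcov hx)
    filter_upwards [Metric.isOpen_ball.mem_nhds hxi] with y hy
    rw [Finset.prod_eq_zero hi (by rw [(hβ i).2.2.1 y hy, sub_self]), sub_zero]
  · change 1 - ∏ i ∈ s, (1 - β i x) = 0
    rw [Finset.prod_eq_one, sub_self]
    intro i hi
    rw [(hβ i).2.2.2.1 x, sub_zero]
    intro hxb
    refine hx (hδW (Metric.mem_thickening_iff.2 ⟨c i, hc i hi, ?_⟩))
    have := Metric.mem_ball.1 hxb
    linarith [(hr i).2]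
  · calc _ ≤ ∫ x, ∑ i ∈ s, ‖fderiv ℝ (β i) x‖ := integral_mono hI hIs hbd
      _ = A * ∑ i ∈ s, r i ^ 2 := by
        rw [integral_finsetSum s fun i _ => (hβ i).2.2.2.2.1, Finset.mul_sum]
        exact Finset.sum_congr rfl fun i _ => (hβ i).2.2.2.2.2
      _ ≤ A * (ε / (A + 1)) := by gcongr
      _ ≤ ε := by
        rw [mul_div_assoc', div_le_iff₀ (by positivity)]; nlinarith

/-! ### Boundary layers of a half space -/

/-- A smooth step function, equal to `0` before `1` and to `1` after `2`. -/
noncomputable def step (u : ℝ) : ℝ := Real.smoothTransition (u - 1)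

theorem contDiff_step : ContDiff ℝ 2 step :=
  (Real.smoothTransition.contDiff (n := 2)).comp (contDiff_id.sub contDiff_const)

theorem step_nonneg (u : ℝ) : 0 ≤ step u := Real.smoothTransition.nonneg _

theorem step_le_one (u : ℝ) : step u ≤ 1 := Real.smoothTransition.le_one _

theorem step_of_le {u : ℝ} (h : u ≤ 1) : step u = 0 :=
  Real.smoothTransition.zero_of_nonpos (by linarith)

theorem step_of_ge {u : ℝ} (h : 2 ≤ u) : step u = 1 :=
  Real.smoothTransition.one_of_one_le (by linarith)

theorem hasDerivAt_step (u : ℝ) : HasDerivAt step (deriv step u) u :=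
  (contDiff_step.differentiable two_ne_zero u).hasDerivAt

theorem deriv_step_nonneg (u : ℝ) : 0 ≤ deriv step u :=
  Monotone.deriv_nonneg fun _ _ h => Real.smoothTransition.monotone (by linarith)

theorem continuous_deriv_step : Continuous (deriv step) :=
  contDiff_step.continuous_deriv one_le_two

theorem deriv_step_of_notMem {u : ℝ} (h : u ∉ Icc (1 : ℝ) 2) : deriv step u = 0 := by
  rcases lt_or_ge u 1 with h1 | h1
  · have : step =ᶠ[𝓝 u] fun _ => 0 := by
      filter_upwards [gt_mem_nhds h1] with v hv using step_of_le (le_of_lt hv)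
    simp [this.deriv_eq]
  · have h2 : 2 < u := by by_contra! h2; exact h ⟨h1, h2⟩
    have : step =ᶠ[𝓝 u] fun _ => 1 := by
      filter_upwards [lt_mem_nhds h2] with v hv using step_of_ge (le_of_lt hv)
    simp [this.deriv_eq]

theorem hasCompactSupport_deriv_step : HasCompactSupport (deriv step) :=
  HasCompactSupport.intro isCompact_Icc fun _ h => deriv_step_of_notMem h

theorem integrable_deriv_step : Integrable (deriv step) :=
  continuous_deriv_step.integrable_of_hasCompactSupport hasCompactSupport_deriv_step

theorem integral_deriv_step : ∫ u, deriv step u = 1 := by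
  rw [integral_of_hasDerivAt_of_tendsto (m := 0) (n := 1) hasDerivAt_step integrable_deriv_step]
  · norm_num
  · exact tendsto_const_nhds.congr' <| by
      filter_upwards [eventually_le_atBot 1] with u hu using (step_of_le hu).symm
  · exact tendsto_const_nhds.congr' <| by
      filter_upwards [eventually_ge_atTop 2] with u hu using (step_of_ge hu).symm

/-- The point of three-space with first coordinate `s` and remaining coordinates `y`. -/
def consR3 (s : ℝ) (y : Fin 2 → ℝ) : R3 := WithLp.toLp 2 (Fin.cons s y)

theorem consR3_zero (s : ℝ) (y : Fin 2 → ℝ) : consR3 s y 0 = s := rfl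

theorem continuous_consR3 : Continuous fun q : ℝ × (Fin 2 → ℝ) => consR3 q.1 q.2 := by
  refine (PiLp.continuous_toLp 2 _).comp (continuous_pi fun i => ?_)
  refine Fin.cases ?_ (fun j => ?_) i
  · simpa using continuous_fst
  · exact (continuous_apply j).comp continuous_snd

theorem norm_le_norm_consR3 (s : ℝ) (y : Fin 2 → ℝ) : ‖y‖ ≤ ‖consR3 s y‖ := by
  rw [pi_norm_le_iff_of_nonneg (norm_nonneg _)]
  intro i
  exact PiLp.norm_apply_le (consR3 s y) i.succ

theorem integral_eq_integral_integral_consR3 {H : R3 → ℝ} (hH : Integrable H) :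
    ∫ x, H x = ∫ s, ∫ y, H (consR3 s y) := by
  have e1 := PiLp.volume_preserving_toLp (Fin 3)
  have e2 := (volume_preserving_piFinSuccAbove (fun _ : Fin 3 => ℝ) 0).symm
  have e := e1.comp e2
  have hm : MeasurableEmbedding (WithLp.toLp 2 ∘ (MeasurableEquiv.piFinSuccAbove
      (fun _ : Fin 3 => ℝ) 0).symm : ℝ × (Fin 2 → ℝ) → R3) :=
    (MeasurableEquiv.toLp 2 (Fin 3 → ℝ)).measurableEmbedding.comp
      (MeasurableEquiv.piFinSuccAbove (fun _ : Fin 3 => ℝ) 0).symm.measurableEmbedding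
  have hfun : ∀ q : ℝ × (Fin 2 → ℝ), (WithLp.toLp 2 ∘ (MeasurableEquiv.piFinSuccAbove
      (fun _ : Fin 3 => ℝ) 0).symm : ℝ × (Fin 2 → ℝ) → R3) q = consR3 q.1 q.2 := fun q => by
    simp [consR3, MeasurableEquiv.piFinSuccAbove_symm_apply]
    rfl
  rw [← e.integral_comp hm H]
  have hi := (e.integrable_comp_emb hm).2 hH
  have hi' : Integrable (fun q : ℝ × (Fin 2 → ℝ) => H (consR3 q.1 q.2)) := by
    refine hi.congr (ae_of_all _ fun q => ?_)
    rw [Function.comp_apply, hfun]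
  simp_rw [hfun]
  exact integral_prod _ hi'

theorem isometry_consR3_zero :
    Isometry fun y : EuclideanSpace ℝ (Fin 2) => consR3 0 y.ofLp := by
  refine Isometry.of_dist_eq fun y z => ?_
  simp [EuclideanSpace.dist_eq, Fin.sum_univ_succ, consR3]

/-- The plane is an isometric copy of the Euclidean plane, where the normalized Hausdorff measure is
Lebesgue measure. -/
theorem restrict_plane : (μHE[2] : Measure R3).restrict {x : R3 | x 0 = 0} =
    (volume : Measure (EuclideanSpace ℝ (Fin 2))).map fun y => consR3 0 y.ofLp := by
  have hr : range (fun y : EuclideanSpace ℝ (Fin 2) => consR3 0 y.ofLp) = {x : R3 | x 0 = 0} := by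
    ext x
    constructor
    · rintro ⟨y, rfl⟩; rfl
    · intro hx
      refine ⟨WithLp.toLp 2 (Fin.tail x.ofLp), ?_⟩
      ext i
      refine Fin.cases ?_ (fun j => ?_) i
      · exact hx.symm
      · rfl
  rw [← hr, ← isometry_consR3_zero.map_euclideanHausdorffMeasure,
    EuclideanSpace.euclideanHausdorffMeasure_eq_volume]

theorem setIntegral_plane (G : R3 → ℝ) :
    ∫ x in {x : R3 | x 0 = 0}, G x ∂μHE[2] = ∫ y, G (consR3 0 y) := by
  rw [restrict_plane, isometry_consR3_zero.isClosedEmbedding.measurableEmbedding.integral_map,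
    ← (PiLp.volume_preserving_toLp (Fin 2)).integral_comp
      (MeasurableEquiv.toLp 2 (Fin 2 → ℝ)).measurableEmbedding]

theorem integrableOn_plane {G : R3 → ℝ} (hG : Continuous G) (hc : HasCompactSupport G) :
    IntegrableOn G {x : R3 | x 0 = 0} μHE[2] := by
  rw [IntegrableOn, restrict_plane,
    isometry_consR3_zero.isClosedEmbedding.measurableEmbedding.integrable_map_iff]
  exact (hG.comp isometry_consR3_zero.continuous).integrable_of_hasCompactSupport
    (hc.comp_isClosedEmbedding isometry_consR3_zero.isClosedEmbedding)

/-- The kernel is an approximate identity in the first coordinate, living on `-2ε ≤ x 0 ≤ -ε`. By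
Fubini and `x 0 = -ε u` the integral becomes `∫ step' u * m (-(ε u))`, with `m` the continuous
function of slice integrals and `∫ step' = 1`. -/
theorem tendsto_integral_mul_deriv_step {G : R3 → ℝ} (hG : Continuous G)
    (hc : HasCompactSupport G) :
    Tendsto (fun ε : ℝ => ∫ x : R3, G x * (ε⁻¹ * deriv step (ε⁻¹ * -(x 0)))) (𝓝[>] 0)
      (𝓝 (∫ x in {x : R3 | x 0 = 0}, G x ∂μHE[2])) := by
  obtain ⟨R, hR⟩ := hc.isCompact.isBounded.exists_norm_le
  obtain ⟨C, hC⟩ := hc.exists_bound_of_continuous hG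
  have hC0 : 0 ≤ C := (norm_nonneg _).trans (hC 0)
  let bd : (Fin 2 → ℝ) → ℝ := (Metric.closedBall 0 R).indicator fun _ => C
  have hbd : Integrable bd := (integrable_indicator_iff Metric.isClosed_closedBall.measurableSet).2
    (integrableOn_const (isCompact_closedBall 0 R).measure_lt_top.ne)
  have hGbd : ∀ s y, ‖G (consR3 s y)‖ ≤ bd y := fun s y => by
    by_cases hy : y ∈ Metric.closedBall (0 : Fin 2 → ℝ) R
    · rw [show bd y = C from indicator_of_mem hy _]; exact hC _
    · have h0 : G (consR3 s y) = 0 := image_eq_zero_of_notMem_tsupport fun h =>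
        hy (mem_closedBall_zero_iff.2 ((norm_le_norm_consR3 s y).trans (hR _ h)))
      rw [show bd y = 0 from indicator_of_notMem hy _, h0, norm_zero]
  let m : ℝ → ℝ := fun s => ∫ y, G (consR3 s y)
  have hGJ : Continuous fun q : ℝ × (Fin 2 → ℝ) => G (consR3 q.1 q.2) := hG.comp continuous_consR3
  have hm : Continuous m := by
    refine continuous_of_dominated (bound := bd) (fun s => ?_) (fun s => ae_of_all _ (hGbd s)) hbd
      (ae_of_all _ fun y => ?_)
    · exact (hGJ.comp (Continuous.prodMk_right s)).aestronglyMeasurable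
    · exact hGJ.comp (Continuous.prodMk_left y)
  have hmb : ∀ s, ‖m s‖ ≤ ∫ y, bd y := fun s =>
    norm_integral_le_of_norm_le hbd (ae_of_all _ (hGbd s))
  have key : ∀ ε : ℝ, 0 < ε → ∫ x : R3, G x * (ε⁻¹ * deriv step (ε⁻¹ * -(x 0)))
      = ∫ u, deriv step u * m (-(ε * u)) := fun ε hε => by
    rw [integral_eq_integral_integral_consR3]
    · simp_rw [consR3_zero, integral_mul_const]
      have h1 := Measure.integral_comp_mul_left (fun u => deriv step u * m (-(ε * u))) (-ε⁻¹)
      have h2 : ∀ s, -(ε * (-ε⁻¹ * s)) = s := fun s => by field_simp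
      simp only [h2] at h1
      have h3 : |(-ε⁻¹)⁻¹| = ε := by rw [inv_neg, inv_inv, abs_neg, abs_of_pos hε]
      rw [h3, smul_eq_mul] at h1
      rw [← mul_right_inj' hε.ne', ← h1, ← integral_const_mul]
      refine integral_congr_ae (ae_of_all _ fun s => ?_)
      simp only [m]
      rw [show ε⁻¹ * -s = -ε⁻¹ * s by ring]
      field_simp
    · refine Continuous.integrable_of_hasCompactSupport ?_ hc.mul_right
      have := continuous_deriv_step
      fun_prop
  have lim : Tendsto (fun ε : ℝ => ∫ u, deriv step u * m (-(ε * u))) (𝓝[>] 0)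
      (𝓝 (∫ u, deriv step u * m 0)) := by
    refine tendsto_integral_filter_of_dominated_convergence
      (fun u => deriv step u * ∫ y, bd y) (Eventually.of_forall fun ε => ?_)
      (Eventually.of_forall fun ε => ae_of_all _ fun u => ?_)
      (integrable_deriv_step.mul_const _) (ae_of_all _ fun u => ?_)
    · have := continuous_deriv_step
      exact Continuous.aestronglyMeasurable (by fun_prop)
    · rw [norm_mul, Real.norm_of_nonneg (deriv_step_nonneg u)]
      exact mul_le_mul_of_nonneg_left (hmb _) (deriv_step_nonneg u)
    · have : Continuous fun ε : ℝ => deriv step u * m (-(ε * u)) := by fun_prop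
      simpa using (this.tendsto 0).mono_left nhdsWithin_le_nhds
  rw [setIntegral_plane]
  rw [integral_mul_const, integral_deriv_step, one_mul] at lim
  exact lim.congr' (by filter_upwards [self_mem_nhdsWithin] with ε hε using (key ε hε).symm)

/-! ### Defining functions and the outward normal -/

/-- `φ` is a regular `C¹` defining function of `Ω` in the open set `U`. -/
structure IsDefiningFunction (Ω U : Set R3) (φ : R3 → ℝ) : Prop where
  isOpen : IsOpen U
  contDiffOn : ContDiffOn ℝ 1 φ U
  fderiv_ne_zero : ∀ x ∈ U, fderiv ℝ φ x ≠ 0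
  inter_eq : Ω ∩ U = {x ∈ U | φ x ≤ 0}

namespace IsDefiningFunction

variable {Ω U V : Set R3} {φ : R3 → ℝ} {x : R3}

theorem mono (h : IsDefiningFunction Ω U φ) (hV : IsOpen V) (hVU : V ⊆ U) :
    IsDefiningFunction Ω V φ where
  isOpen := hV
  contDiffOn := h.contDiffOn.mono hVU
  fderiv_ne_zero x hx := h.fderiv_ne_zero x (hVU hx)
  inter_eq := by
    ext x
    have := Set.ext_iff.1 h.inter_eq x
    constructor
    · rintro ⟨h1, h2⟩; exact ⟨h2, (this.1 ⟨h1, hVU h2⟩).2⟩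
    · rintro ⟨h1, h2⟩; exact ⟨(this.2 ⟨hVU h1, h2⟩).1, h1⟩

theorem contDiffAt (h : IsDefiningFunction Ω U φ) (hx : x ∈ U) : ContDiffAt ℝ 1 φ x :=
  h.contDiffOn.contDiffAt (h.isOpen.mem_nhds hx)

theorem continuousOn_fderiv (h : IsDefiningFunction Ω U φ) : ContinuousOn (fderiv ℝ φ) U :=
  h.contDiffOn.continuousOn_fderiv_of_isOpen h.isOpen le_rfl

theorem mem_iff (h : IsDefiningFunction Ω U φ) (hx : x ∈ U) : x ∈ Ω ↔ φ x ≤ 0 := by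
  have := Set.ext_iff.1 h.inter_eq x
  simpa [hx] using this

/-- An interior point with `φ x = 0` would be a local maximum of `φ`, against the nonvanishing of
the differential. -/
theorem mem_interior_iff (h : IsDefiningFunction Ω U φ) (hx : x ∈ U) :
    x ∈ interior Ω ↔ φ x < 0 := by
  constructor
  · intro hi
    have hΩ := mem_interior_iff_mem_nhds.1 hi
    refine lt_of_le_of_ne ((h.mem_iff hx).1 (interior_subset hi)) fun h0 => ?_
    refine h.fderiv_ne_zero x hx (IsLocalMax.fderiv_eq_zero ?_)
    filter_upwards [hΩ, h.isOpen.mem_nhds hx] with y hy hyU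
    rw [h0]
    exact (h.mem_iff hyU).1 hy
  · intro hlt
    refine mem_interior_iff_mem_nhds.2 ?_
    filter_upwards [(h.contDiffAt hx).continuousAt.eventually (gt_mem_nhds hlt),
      h.isOpen.mem_nhds hx] with y hy hyU
    exact (h.mem_iff hyU).2 (le_of_lt hy)

theorem mem_frontier_iff (h : IsDefiningFunction Ω U φ) (hΩ : IsClosed Ω) (hx : x ∈ U) :
    x ∈ frontier Ω ↔ φ x = 0 := by
  rw [hΩ.frontier_eq, Set.mem_sdiff, h.mem_interior_iff hx, h.mem_iff hx, not_lt]
  exact ⟨fun h => le_antisymm h.1 h.2, fun h => ⟨h.le, h.ge⟩⟩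

theorem gradient_ne_zero (h : IsDefiningFunction Ω U φ) (hx : x ∈ U) : gradient φ x ≠ 0 := by
  have := h.fderiv_ne_zero x hx
  simpa [gradient] using this

theorem isOutwardUnitNormal (h : IsDefiningFunction Ω U φ) (hx : x ∈ U) (h0 : φ x = 0) :
    IsOutwardUnitNormal Ω x (‖gradient φ x‖⁻¹ • gradient φ x) :=
  ⟨U, φ, h.isOpen, hx, h.contDiffOn, h0, h.gradient_ne_zero hx, h.inter_eq, rfl⟩

end IsDefiningFunction

theorem inner_gradient (φ : R3 → ℝ) (x v : R3) : inner ℝ (gradient φ x) v = fderiv ℝ φ x v := by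
  simp [gradient]

theorem IsOutwardUnitNormal.norm_eq_one {Ω : Set R3} {p n : R3} (h : IsOutwardUnitNormal Ω p n) :
    ‖n‖ = 1 := by
  obtain ⟨U, φ, -, -, -, -, hg, -, rfl⟩ := h
  rw [norm_smul, norm_inv, norm_norm, inv_mul_cancel₀ (norm_ne_zero_iff.2 hg)]

/-- Dividing `φ` by `|∇φ(p)|` makes its differential at `p` exactly `⟨n, ·⟩`; shrinking `U` keeps
the gradient nonzero throughout. -/
theorem IsOutwardUnitNormal.exists_isDefiningFunction {Ω : Set R3} {p n : R3}
    (h : IsOutwardUnitNormal Ω p n) : ∃ U φ, IsDefiningFunction Ω U φ ∧ p ∈ U ∧ φ p = 0 ∧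
      ∀ v, fderiv ℝ φ p v = inner ℝ n v := by
  obtain ⟨U, φ, hU, hp, hφ, h0, hg, hΩ, rfl⟩ := h
  set a := ‖gradient φ p‖⁻¹ with ha
  have ha0 : 0 < a := inv_pos.2 (norm_pos_iff.2 hg)
  have hfd : ∀ x ∈ U, fderiv ℝ (fun x => a * φ x) x = a • fderiv ℝ φ x := fun x hx => by
    have := (hφ.contDiffAt (hU.mem_nhds hx)).differentiableAt one_ne_zero
    simpa using fderiv_const_mul this a
  have hcont := hφ.continuousOn_fderiv_of_isOpen hU le_rfl
  have hV : IsOpen (U ∩ fderiv ℝ φ ⁻¹' {0}ᶜ) := hcont.isOpen_inter_preimage hU isOpen_compl_singleton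
  have hpV : fderiv ℝ φ p ≠ 0 := by
    intro h; apply hg; simp [gradient, h]
  refine ⟨U ∩ fderiv ℝ φ ⁻¹' {0}ᶜ, fun x => a * φ x,
    ⟨hV, contDiffOn_const.mul (hφ.mono inter_subset_left), fun x hx => ?_, ?_⟩, ⟨hp, hpV⟩,
      by simp [h0], fun v => ?_⟩
  · rw [hfd x hx.1]
    exact smul_ne_zero ha0.ne' hx.2
  · ext x
    have := Set.ext_iff.1 hΩ x
    simp only [mem_inter_iff, mem_ofPred_eq] at this ⊢
    have h3 : a * φ x ≤ 0 ↔ φ x ≤ 0 := by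
      constructor
      · intro h; by_contra! h'; exact absurd (mul_pos ha0 h') (not_lt.2 h)
      · exact mul_nonpos_of_nonneg_of_nonpos ha0.le
    tauto
  · rw [hfd p hp, smul_apply, inner_smul_left, inner_gradient]; rfl

/-- If `n ≠ n'`, a short move from `p` along `n' - n` decreases `φ` and increases `φ'`, so it would
end both inside and outside `Ω`. -/
theorem IsOutwardUnitNormal.unique {Ω : Set R3} {p n n' : R3} (h : IsOutwardUnitNormal Ω p n)
    (h' : IsOutwardUnitNormal Ω p n') : n = n' := by
  obtain ⟨U, φ, hφ, hp, h0, hd⟩ := h.exists_isDefiningFunction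
  obtain ⟨U', φ', hφ', hp', h0', hd'⟩ := h'.exists_isDefiningFunction
  have hn := h.norm_eq_one
  have hn' := h'.norm_eq_one
  by_contra hne
  have hlt : inner ℝ n n' < 1 := (inner_lt_one_iff_real_of_norm_eq_one hn hn').2 hne
  set v := n' - n
  have hline : HasDerivAt (fun t : ℝ => p + t • v) v 0 := by
    simpa using ((hasDerivAt_id (0 : ℝ)).smul_const v).const_add p
  have e0 : p + (0 : ℝ) • v = p := by simp
  have hc : ∀ ψ : R3 → ℝ, DifferentiableAt ℝ ψ p →
      HasDerivAt (fun t : ℝ => ψ (p + t • v)) (fderiv ℝ ψ p v) 0 := fun ψ hψ => by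
    have : HasFDerivAt ψ (fderiv ℝ ψ p) (p + (0 : ℝ) • v) := by rw [e0]; exact hψ.hasFDerivAt
    exact this.comp_hasDerivAt 0 hline
  have d1 := hc φ ((hφ.contDiffAt hp).differentiableAt one_ne_zero)
  have d2 := hc φ' ((hφ'.contDiffAt hp').differentiableAt one_ne_zero)
  have s1 : fderiv ℝ φ p v < 0 := by
    rw [hd, inner_sub_right, real_inner_self_eq_norm_sq, hn]; linarith
  have s2 : 0 < fderiv ℝ φ' p v := by
    rw [hd', inner_sub_right, real_inner_self_eq_norm_sq, hn', real_inner_comm]; linarith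
  have hcont : Tendsto (fun t : ℝ => p + t • v) (𝓝[>] 0) (𝓝 p) := by
    have : Continuous fun t : ℝ => p + t • v := by fun_prop
    simpa using (this.tendsto 0).mono_left nhdsWithin_le_nhds
  have e1 := (hasDerivAt_iff_tendsto_slope.1 d1).mono_left
    (nhdsWithin_mono 0 (s := Ioi 0) fun t ht => ne_of_gt ht)
  have e2 := (hasDerivAt_iff_tendsto_slope.1 d2).mono_left
    (nhdsWithin_mono 0 (s := Ioi 0) fun t ht => ne_of_gt ht)
  obtain ⟨t, ht, hs1, hs2, hU, hU'⟩ := (Filter.Eventually.and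
    (show ∀ᶠ t in 𝓝[>] (0 : ℝ), t ∈ Ioi (0 : ℝ) from self_mem_nhdsWithin) ((e1.eventually (gt_mem_nhds s1)).and ((e2.eventually (lt_mem_nhds s2)).and
      ((hcont.eventually (hφ.isOpen.mem_nhds hp)).and
        (hcont.eventually (hφ'.isOpen.mem_nhds hp')))))).exists
  replace ht : (0 : ℝ) < t := ht
  simp only [slope_def_field, e0, h0, h0', sub_zero] at hs1 hs2
  have hl : φ (p + t • v) ≤ 0 := by
    by_contra! h; exact absurd (div_pos h ht) (not_lt.2 hs1.le)
  have hg : 0 < φ' (p + t • v) := by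
    by_contra! h; exact absurd (div_nonpos_of_nonpos_of_nonneg h ht.le) (not_le.2 hs2)
  exact absurd ((hφ'.mem_iff hU').1 ((hφ.mem_iff hU).2 hl)) (not_le.2 hg)

open Classical in
/-- The outward unit normal of `Ω` at `p`, if it exists. -/
noncomputable def outwardNormal (Ω : Set R3) (p : R3) : R3 :=
  if h : ∃ n, IsOutwardUnitNormal Ω p n then h.choose else 0

theorem IsOutwardUnitNormal.outwardNormal_eq {Ω : Set R3} {p n : R3}
    (h : IsOutwardUnitNormal Ω p n) : outwardNormal Ω p = n := by
  have hex : ∃ n, IsOutwardUnitNormal Ω p n := ⟨n, h⟩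
  rw [outwardNormal, dif_pos hex]
  exact hex.choose_spec.unique h

theorem norm_outwardNormal_le (Ω : Set R3) (p : R3) : ‖outwardNormal Ω p‖ ≤ 1 := by
  by_cases h : ∃ n, IsOutwardUnitNormal Ω p n
  · obtain ⟨n, hn⟩ := h
    rw [hn.outwardNormal_eq, hn.norm_eq_one]
  · rw [outwardNormal, dif_neg h]; simp

/-- The boundary points without outward normal. -/
def singularSet (Ω : Set R3) : Set R3 := {p ∈ frontier Ω | ¬ ∃ n, IsOutwardUnitNormal Ω p n}

/-- A defining function at one boundary point supplies normals at all nearby boundary points.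
Closedness makes the singular set compact, as the finite ball cover requires. -/
theorem isClosed_singularSet {Ω : Set R3} (hΩ : IsClosed Ω) : IsClosed (singularSet Ω) := by
  rw [← isOpen_compl_iff, isOpen_iff_mem_nhds]
  intro p hp
  by_cases hf : p ∈ frontier Ω
  · obtain ⟨n, hn⟩ : ∃ n, IsOutwardUnitNormal Ω p n := by
      by_contra h; exact hp ⟨hf, h⟩
    obtain ⟨U, φ, hφ, hpU, -, -⟩ := hn.exists_isDefiningFunction
    filter_upwards [hφ.isOpen.mem_nhds hpU] with x hx hxs
    exact hxs.2 ⟨_, hφ.isOutwardUnitNormal hx ((hφ.mem_frontier_iff hΩ hx).1 hxs.1)⟩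
  · filter_upwards [isClosed_frontier.isOpen_compl.mem_nhds hf] with x hx hxs
    exact hx hxs.1

theorem continuousWithinAt_outwardNormal {Ω : Set R3} (hΩ : IsClosed Ω) {p n : R3}
    (h : IsOutwardUnitNormal Ω p n) :
    ContinuousWithinAt (outwardNormal Ω) (frontier Ω) p := by
  obtain ⟨U, φ, hφ, hpU, h0, -⟩ := h.exists_isDefiningFunction
  have hg : ContinuousAt (gradient φ) p :=
    (InnerProductSpace.toDual ℝ R3).symm.continuous.continuousAt.comp
      (hφ.continuousOn_fderiv.continuousAt (hφ.isOpen.mem_nhds hpU))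
  have hg' : ContinuousAt (fun x => ‖gradient φ x‖⁻¹ • gradient φ x) p :=
    (hg.norm.inv₀ (norm_ne_zero_iff.2 (hφ.gradient_ne_zero hpU))).smul hg
  refine hg'.continuousWithinAt.congr_of_eventuallyEq ?_
    (hφ.isOutwardUnitNormal hpU h0).outwardNormal_eq
  filter_upwards [self_mem_nhdsWithin, mem_nhdsWithin_of_mem_nhds (hφ.isOpen.mem_nhds hpU)]
    with x hx hxU
  exact (hφ.isOutwardUnitNormal hxU ((hφ.mem_frontier_iff hΩ hxU).1 hx)).outwardNormal_eq

/-! ### The form `dσ` on tangent frames -/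

theorem exists_orthonormalBasis {n : R3} (hn : ‖n‖ = 1) :
    ∃ b : OrthonormalBasis (Fin 3) ℝ R3, b 0 = n := by
  have ho : Orthonormal ℝ (({0} : Set (Fin 3)).domRestrict fun _ => n) := by
    rw [orthonormal_iff_ite]
    intro i j
    have : i = j := Subsingleton.elim _ _
    simp [this, hn]
  obtain ⟨b, hb⟩ := ho.exists_orthonormalBasis_extension_of_card_eq (by simp)
  exact ⟨b, hb 0 rfl⟩

theorem inner_eq (v w : R3) : inner ℝ v w = v 0 * w 0 + v 1 * w 1 + v 2 * w 2 := by
  simp [PiLp.inner_apply, Fin.sum_univ_three, mul_comm]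

@[simp] theorem qi_re : qi.re = 0 := rfl
@[simp] theorem qi_imI : qi.imI = 1 := rfl
@[simp] theorem qi_imJ : qi.imJ = 0 := rfl
@[simp] theorem qi_imK : qi.imK = 0 := rfl
@[simp] theorem qj_re : qj.re = 0 := rfl
@[simp] theorem qj_imI : qj.imI = 0 := rfl
@[simp] theorem qj_imJ : qj.imJ = 1 := rfl
@[simp] theorem qj_imK : qj.imK = 0 := rfl

/-- The quaternion `n₀ + i n₁ + j n₂`. -/
noncomputable def normalQuat (n : R3) : ℍ := (n 0) • (1 : ℍ) + (n 1) • qi + (n 2) • qj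

/-- For a rotation matrix the adjugate is the inverse. Entrywise this says that each row is the
cross product of the other two in cyclic order, so `n = t₀ × t₁` for a positive frame. -/
theorem adjugate_eq_transpose {M : Matrix (Fin 3) (Fin 3) ℝ} (hM : M * M.transpose = 1)
    (hpos : 0 < M.det) : M.adjugate = M.transpose := by
  have hd2 : M.det * M.det = 1 := by
    have := congrArg Matrix.det hM
    rwa [Matrix.det_mul, Matrix.det_transpose, Matrix.det_one] at this
  have hd : M.det = 1 := by nlinarith
  calc M.adjugate = M.adjugate * (M * M.transpose) := by rw [hM, mul_one]
    _ = M.transpose := by rw [← mul_assoc, Matrix.adjugate_mul, hd, one_smul, one_mul]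

/-- The coefficients of `1, i, j` in `dσ(t₀, t₁)` are the coordinates of `t₀ × t₁`, the sign in `-i
dx ∧ dz` being that of the middle one. In particular the value does not depend on the frame. -/
theorem IsPositiveTangentFrame.dsigma_eq {Ω : Set R3} {p n : R3} {t : Fin 2 → R3}
    (hn : IsOutwardUnitNormal Ω p n) (ht : IsPositiveTangentFrame Ω p t) :
    dsigma (t 0) (t 1) = normalQuat n := by
  obtain ⟨n', hn', ho, hperp, hdet⟩ := ht
  obtain rfl := hn'.unique hn
  set M : Matrix (Fin 3) (Fin 3) ℝ := Matrix.of fun a b : Fin 3 => (![n', t 0, t 1] a) b with hM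
  have hnn : inner ℝ n' n' = (1 : ℝ) := by
    rw [real_inner_self_eq_norm_sq, hn.norm_eq_one, one_pow]
  have h00 := orthonormal_iff_ite.1 ho 0 0
  have h01 := orthonormal_iff_ite.1 ho 0 1
  have h11 := orthonormal_iff_ite.1 ho 1 1
  have hp0 := hperp 0
  have hp1 := hperp 1
  rw [inner_eq] at hnn hp0 hp1
  rw [inner_eq, if_pos rfl] at h00 h11
  rw [inner_eq, if_neg (by decide)] at h01
  have hMM : M * M.transpose = 1 := by
    ext i j
    fin_cases i <;> fin_cases j <;>
      simp [hM, Matrix.mul_apply, Fin.sum_univ_three] <;> linarith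
  have hadj := adjugate_eq_transpose hMM hdet
  have c0 := congrFun (congrFun hadj 0) 0
  have c1 := congrFun (congrFun hadj 1) 0
  have c2 := congrFun (congrFun hadj 2) 0
  simp [Matrix.adjugate_fin_three, hM] at c0 c1 c2
  ext <;> simp [dsigma, normalQuat, coordWedge] <;> linarith

theorem IsOutwardUnitNormal.exists_isPositiveTangentFrame {Ω : Set R3} {p n : R3}
    (hn : IsOutwardUnitNormal Ω p n) : ∃ t, IsPositiveTangentFrame Ω p t := by
  obtain ⟨b, hb⟩ := exists_orthonormalBasis hn.norm_eq_one
  have ho := b.orthonormal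
  have hdet : Matrix.det (Matrix.of fun i j : Fin 3 => (![n, b 1, b 2] i) j) ≠ 0 := by
    intro h0
    obtain ⟨v, hv, hv0⟩ := Matrix.exists_mulVec_eq_zero_iff.2 h0
    apply hv
    have h1 : ∀ i, inner ℝ (b i) (WithLp.toLp 2 v : R3) = (0 : ℝ) := fun i => by
      have := congrFun hv0 i
      simp only [Matrix.mulVec, dotProduct, Fin.sum_univ_three] at this
      fin_cases i <;> simp [PiLp.inner_apply, Fin.sum_univ_three, hb] at this ⊢ <;> linarith
    have h2 : (WithLp.toLp 2 v : R3) = 0 := by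
      rw [← b.sum_repr' (WithLp.toLp 2 v : R3)]
      simp [h1]
    simpa using h2
  have horth : ∀ i j, i ≠ j → inner ℝ (b i) (b j) = (0 : ℝ) := fun i j h => ho.2 h
  -- A negatively oriented frame is corrected by swapping its two vectors.
  rcases lt_or_gt_of_ne hdet with hneg | hpos
  · refine ⟨![b 2, b 1], n, hn, ?_, fun a => ?_, ?_⟩
    · have e : ![b 2, b 1] = b ∘ ![2, 1] := by funext i; fin_cases i <;> rfl
      rw [e]
      exact ho.comp ![2, 1] (by decide)
    · rw [← hb]; fin_cases a <;> exact horth _ _ (by decide)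
    · simp [Matrix.det_fin_three] at hneg ⊢; linarith
  · refine ⟨![b 1, b 2], n, hn, ?_, fun a => ?_, ?_⟩
    · have e : ![b 1, b 2] = b ∘ ![1, 2] := by funext i; fin_cases i <;> rfl
      rw [e]
      exact ho.comp ![1, 2] (by decide)
    · rw [← hb]; fin_cases a <;> exact horth _ _ (by decide)
    · simpa using hpos

theorem IsOutwardUnitNormal.dsigmaDensity_eq {Ω : Set R3} {p n : R3}
    (hn : IsOutwardUnitNormal Ω p n) : dsigmaDensity Ω p = normalQuat n := by
  have hex := hn.exists_isPositiveTangentFrame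
  rw [dsigmaDensity, dif_pos hex]
  exact IsPositiveTangentFrame.dsigma_eq hn hex.choose_spec

/-! ### Almost isometric boundary charts -/

/-- Near a boundary point with an outward normal, `Ω` can be flattened to the half space
`{y | y 0 ≤ 0}` by a chart which is bi-Lipschitz with a constant as close to `1` as desired. -/
theorem exists_chart {Ω U : Set R3} {φ : R3 → ℝ} {p n : R3} (hφ : IsDefiningFunction Ω U φ)
    (hp : p ∈ U) (hn : ‖n‖ = 1) (hd : ∀ v, fderiv ℝ φ p v = inner ℝ n v) {K : NNReal}
    (hK : 1 < K) : ∃ Ψ : OpenPartialHomeomorph R3 R3, p ∈ Ψ.source ∧ Ψ.source ⊆ U ∧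
      (∀ x ∈ Ψ.source, Ψ x 0 = φ x) ∧ LipschitzOnWith K Ψ Ψ.source ∧
      ∀ x ∈ Ψ.source, ∀ y ∈ Ψ.source, dist x y ≤ K * dist (Ψ x) (Ψ y) := by
  obtain ⟨b, hb⟩ := exists_orthonormalBasis hn
  let B : R3 ≃L[ℝ] R3 := b.repr.toContinuousLinearEquiv
  have hB0 : ∀ x, B x 0 = inner ℝ n x := fun x => by
    rw [← hb]; exact b.repr_apply_apply x 0
  have hBn : ∀ x, ‖B x‖ = ‖x‖ := fun x => b.repr.norm_map x
  let e0 : R3 := EuclideanSpace.single 0 1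
  -- The isometry `B` with its first coordinate `⟨n, x⟩` replaced by `φ`. Since `dφ(p) = ⟨n, ·⟩`,
  -- its derivative at `p` is still `B`.
  let f : R3 → R3 := fun x => B x + (φ x - inner ℝ n x) • e0
  have hf0 : ∀ x, f x 0 = φ x := fun x => by
    simp [f, e0, hB0]
  have hstrict : HasStrictFDerivAt f (B : R3 →L[ℝ] R3) p := by
    have h1 := (hφ.contDiffAt hp).hasStrictFDerivAt one_ne_zero
    have h2 : HasStrictFDerivAt (fun x => inner ℝ n x) (innerSL ℝ n) p :=
      (innerSL ℝ n).hasStrictFDerivAt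
    have hz : fderiv ℝ φ p - innerSL ℝ n = 0 := by ext v; simp [hd]
    have h3 := (h1.sub h2).smul_const e0
    have h4 := (B : R3 →L[ℝ] R3).hasStrictFDerivAt (x := p) |>.add h3
    rw [hz, ContinuousLinearMap.zero_smulRight, add_zero] at h4
    exact h4
  have hK0 : (0 : ℝ) < K := lt_trans one_pos (by exact_mod_cast hK)
  have hK1 : (1 : ℝ) < K := by exact_mod_cast hK
  -- If `f - B` is `c`-Lipschitz, `f` expands distances by at most `1 + c = 2 - K⁻¹ ≤ K` and
  -- contracts them by at most `1 - c = K⁻¹`.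
  let c : NNReal := 1 - K⁻¹
  have hKinv : K⁻¹ < 1 := inv_lt_one_of_one_lt₀ hK
  have hc : (c : ℝ) = 1 - (K : ℝ)⁻¹ := by
    rw [NNReal.coe_sub hKinv.le]; simp
  have hc0 : 0 < c := tsub_pos_of_lt hKinv
  obtain ⟨s, hs, happ⟩ := hstrict.approximates_deriv_on_nhds (c := c) (Or.inr hc0)
  obtain ⟨V, hVs, hV, hpV⟩ := mem_nhds_iff.1 (inter_mem hs (hφ.isOpen.mem_nhds hp))
  have happV : ApproximatesLinearOn f (B : R3 →L[ℝ] R3) V c :=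
    happ.mono_set (hVs.trans inter_subset_left)
  have hnormB : ‖(B.symm : R3 →L[ℝ] R3)‖₊ = 1 := by
    ext
    exact b.repr.symm.toLinearIsometry.norm_toContinuousLinearMap
  have hc1 : c < ‖(B.symm : R3 →L[ℝ] R3)‖₊⁻¹ := by
    rw [hnormB, inv_one]
    exact tsub_lt_self one_pos (inv_pos.2 (one_pos.trans hK))
  let Ψ := happV.toOpenPartialHomeomorph f V (Or.inr hc1) hV
  have hsub : ∀ x ∈ V, ∀ y ∈ V, ‖(f x - f y) - B (x - y)‖ ≤ c * ‖x - y‖ := fun x hx y hy =>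
    happV x hx y hy
  refine ⟨Ψ, hpV, hVs.trans inter_subset_right, fun x _ => hf0 x, ?_, ?_⟩
  · refine LipschitzOnWith.of_dist_le_mul fun x hx y hy => ?_
    rw [dist_eq_norm, dist_eq_norm]
    have h1 := hsub x hx y hy
    have h2 : ‖f x - f y‖ ≤ ‖x - y‖ + c * ‖x - y‖ := by
      rw [← hBn (x - y)] at *
      calc ‖f x - f y‖ = ‖B (x - y) + ((f x - f y) - B (x - y))‖ := by congr 1; abel
        _ ≤ _ := (norm_add_le _ _).trans (by gcongr)
    have h3 : 1 + (c : ℝ) ≤ K := by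
      rw [hc]
      have : (K : ℝ)⁻¹ * K = 1 := inv_mul_cancel₀ hK0.ne'
      have := inv_pos.2 hK0
      nlinarith [sq_nonneg ((K : ℝ) - 1)]
    calc ‖f x - f y‖ ≤ (1 + c) * ‖x - y‖ := by linarith
      _ ≤ _ := by gcongr
  · intro x hx y hy
    rw [dist_eq_norm, dist_eq_norm]
    have h1 := hsub x hx y hy
    have h2 : ‖x - y‖ ≤ ‖f x - f y‖ + c * ‖x - y‖ := by
      have : ‖B (x - y)‖ ≤ ‖f x - f y‖ + ‖(f x - f y) - B (x - y)‖ := by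
        calc ‖B (x - y)‖ = ‖(f x - f y) - ((f x - f y) - B (x - y))‖ := by congr 1; abel
          _ ≤ _ := norm_sub_le _ _
      rw [hBn] at this
      linarith
    rw [hc] at h2
    have h3 : (K : ℝ)⁻¹ * ‖x - y‖ ≤ ‖f x - f y‖ := by linarith
    rwa [inv_mul_le_iff₀ hK0] at h3

/-- A function with compact support in the source of a chart, read in the chart. -/
theorem exists_pushforward {X Y : Type*} [TopologicalSpace X] [TopologicalSpace Y] [T2Space Y]
    (Ψ : OpenPartialHomeomorph X Y) {ψ : X → ℝ} (hψ : Continuous ψ) (hc : HasCompactSupport ψ)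
    (hs : tsupport ψ ⊆ Ψ.source) : ∃ G : Y → ℝ, Continuous G ∧ HasCompactSupport G ∧
      (∀ x ∈ Ψ.source, G (Ψ x) = ψ x) ∧ (∀ y ∉ Ψ.target, G y = 0) ∧
      ∀ y, ∃ x, G y = ψ x ∨ G y = 0 := by
  classical
  let G : Y → ℝ := fun y => if y ∈ Ψ.target then ψ (Ψ.symm y) else 0
  have hT : IsCompact (Ψ '' tsupport ψ) :=
    hc.isCompact.image_of_continuousOn (Ψ.continuousOn.mono hs)
  have hG0 : ∀ y ∉ Ψ '' tsupport ψ, G y = 0 := fun y hy => by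
    by_cases hyt : y ∈ Ψ.target
    · simp only [G, if_pos hyt]
      exact image_eq_zero_of_notMem_tsupport fun h => hy ⟨_, h, Ψ.right_inv hyt⟩
    · simp only [G, if_neg hyt]
  have hGc : HasCompactSupport G := HasCompactSupport.intro hT hG0
  have hGon : ContinuousOn G Ψ.target :=
    (hψ.comp_continuousOn Ψ.continuousOn_symm).congr fun y hy => by simp [G, hy]
  have hsub : tsupport G ⊆ Ψ.target := by
    refine (closure_minimal (fun y hy => ?_) hT.isClosed).trans
      (image_subset_iff.2 fun x hx => Ψ.map_source (hs hx))
    by_contra h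
    exact hy (hG0 y h)
  refine ⟨G, hGon.continuous_of_tsupport_subset Ψ.open_target hsub, hGc, fun x hx => ?_,
    fun y hy => by simp [G, hy], fun y => ?_⟩
  · simp [G, Ψ.map_source hx, Ψ.left_inv hx]
  · by_cases hyt : y ∈ Ψ.target
    · exact ⟨Ψ.symm y, Or.inl (by simp [G, hyt])⟩
    · exact ⟨Ψ.symm y, Or.inr (by simp [G, hyt])⟩

/-! ### The local flux estimate at a regular boundary point -/

/-- `F` is divergence free in `O` in the sense of distributions. -/
def WeaklyDivFree (F : R3 → R3) (O : Set R3) : Prop :=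
  ∀ η : R3 → ℝ, ContDiff ℝ 1 η → HasCompactSupport η → tsupport η ⊆ O →
    ∫ x, fderiv ℝ η x (F x) = 0

section Local

variable {Ω U : Set R3} {φ ψ : R3 → ℝ} {F : R3 → R3}

theorem continuous_fderiv_apply (hF : Continuous F) (hψ : ContDiff ℝ 1 ψ) :
    Continuous fun x => fderiv ℝ ψ x (F x) :=
  (hψ.continuous_fderiv one_ne_zero).clm_apply hF

theorem fderiv_eq_zero_of_notMem {x : R3} (hx : x ∉ tsupport ψ) : fderiv ℝ ψ x = 0 :=
  image_eq_zero_of_notMem_tsupport fun h => hx (tsupport_fderiv_subset ℝ h)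

theorem tsupport_fderiv_apply_subset : tsupport (fun x => fderiv ℝ ψ x (F x)) ⊆ tsupport ψ :=
  closure_minimal (fun x hx => by
    by_contra h
    exact hx (by simp [fderiv_eq_zero_of_notMem h])) (isClosed_tsupport ψ)

theorem hasCompactSupport_fderiv_apply (hc : HasCompactSupport ψ) :
    HasCompactSupport fun x => fderiv ℝ ψ x (F x) :=
  hc.mono' (subset_closure.trans tsupport_fderiv_apply_subset)

theorem integrable_fderiv_apply (hF : Continuous F) (hψ : ContDiff ℝ 1 ψ)
    (hc : HasCompactSupport ψ) : Integrable fun x => fderiv ℝ ψ x (F x) :=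
  (continuous_fderiv_apply hF hψ).integrable_of_hasCompactSupport
    (hasCompactSupport_fderiv_apply hc)

theorem continuous_mul_of_continuousOn {a b : R3 → ℝ} (hU : IsOpen U) (ha : Continuous a)
    (hs : tsupport a ⊆ U) (hb : ContinuousOn b U) : Continuous fun x => a x * b x :=
  (ha.continuousOn.mul hb).continuous_of_tsupport_subset hU (tsupport_mul_subset_left.trans hs)

theorem IsDefiningFunction.continuousOn_step (hφ : IsDefiningFunction Ω U φ) (ε : ℝ) :
    ContinuousOn (fun x => step (ε⁻¹ * -φ x)) U :=
  contDiff_step.continuous.comp_continuousOn (continuousOn_const.mul hφ.contDiffOn.continuousOn.neg)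

theorem IsDefiningFunction.continuousOn_deriv_step (hφ : IsDefiningFunction Ω U φ) (ε : ℝ) :
    ContinuousOn (fun x => ε⁻¹ * deriv step (ε⁻¹ * -φ x)) U :=
  continuousOn_const.mul (continuous_deriv_step.comp_continuousOn
    (continuousOn_const.mul hφ.contDiffOn.continuousOn.neg))

/-- Testing `F` with the product of `ψ` and a function which cuts off the boundary layer of
width `ε`. -/
theorem integral_step_mul_fderiv (hφ : IsDefiningFunction Ω U φ) (hF : Continuous F)
    (hFw : WeaklyDivFree F (interior Ω)) (hψ : ContDiff ℝ 1 ψ) (hc : HasCompactSupport ψ)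
    (hs : tsupport ψ ⊆ U) {ε : ℝ} (hε : 0 < ε) :
    ∫ x, fderiv ℝ ψ x (F x) * step (ε⁻¹ * -φ x) =
      ∫ x, ψ x * (ε⁻¹ * deriv step (ε⁻¹ * -φ x)) * fderiv ℝ φ x (F x) := by
  let η : R3 → ℝ := fun x => ψ x * step (ε⁻¹ * -φ x)
  have hηs : tsupport η ⊆ tsupport ψ := tsupport_mul_subset_left
  have hη : ContDiff ℝ 1 η := contDiff_iff_contDiffAt.2 fun x => by
    by_cases hx : x ∈ tsupport ψ
    · exact hψ.contDiffAt.mul ((contDiff_step.of_le one_le_two).contDiffAt.comp x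
        (contDiffAt_const.mul (hφ.contDiffAt (hs hx)).neg))
    · have : η =ᶠ[𝓝 x] fun _ => 0 := notMem_tsupport_iff_eventuallyEq.1 fun h => hx (hηs h)
      exact contDiffAt_const.congr_of_eventuallyEq this
  have hηc : HasCompactSupport η := hc.mul_right
  -- The step factor vanishes where `φ > -ε`, so the support of `η` stays in the closed set `{φ ≤
  -- -ε}`, well inside `Ω`.
  have hηO : tsupport η ⊆ interior Ω := by
    have hcl : IsClosed (tsupport ψ ∩ φ ⁻¹' Iic (-ε)) :=
      (hφ.contDiffOn.continuousOn.mono hs).preimage_isClosed_of_isClosed (isClosed_tsupport ψ)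
        isClosed_Iic
    refine (closure_minimal (fun x hx => ?_) hcl).trans fun x hx => ?_
    · have hxψ : x ∈ tsupport ψ := hηs (subset_closure hx)
      refine ⟨hxψ, ?_⟩
      by_contra hlt
      have hlt : -ε < φ x := not_le.1 hlt
      refine hx ?_
      have : ε⁻¹ * -φ x ≤ 1 := by rw [inv_mul_le_iff₀ hε]; linarith
      change ψ x * step (ε⁻¹ * -φ x) = 0
      rw [step_of_le this, mul_zero]
    · have : φ x ≤ -ε := hx.2
      exact (hφ.mem_interior_iff (hs hx.1)).2 (by linarith)
  have hder : ∀ x, fderiv ℝ η x (F x) = fderiv ℝ ψ x (F x) * step (ε⁻¹ * -φ x) -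
      ψ x * (ε⁻¹ * deriv step (ε⁻¹ * -φ x)) * fderiv ℝ φ x (F x) := fun x => by
    by_cases hx : x ∈ tsupport ψ
    · have h1 := (hψ.differentiable one_ne_zero x).hasFDerivAt
      have h2 := ((hφ.contDiffAt (hs hx)).differentiableAt one_ne_zero).hasFDerivAt
      have h3 := (hasDerivAt_step (ε⁻¹ * -φ x)).comp_hasFDerivAt x (h2.neg.const_mul ε⁻¹)
      have h4 := (h1.mul h3).fderiv
      change fderiv ℝ (ψ * step ∘ fun y => ε⁻¹ * (-φ) y) x (F x) = _
      rw [h4]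
      simp
      ring
    · rw [fderiv_eq_zero_of_notMem hx, fderiv_eq_zero_of_notMem fun h => hx (hηs h),
        image_eq_zero_of_notMem_tsupport hx]
      simp
  have h0 := hFw η hη hηc hηO
  simp_rw [hder] at h0
  have hc1 : HasCompactSupport fun x => fderiv ℝ ψ x (F x) * step (ε⁻¹ * -φ x) :=
    (hasCompactSupport_fderiv_apply hc).mul_right
  have hc2 : HasCompactSupport
      fun x => ψ x * (ε⁻¹ * deriv step (ε⁻¹ * -φ x)) * fderiv ℝ φ x (F x) :=
    hc.mul_right.mul_right
  rw [integral_sub] at h0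
  · linarith
  · exact (continuous_mul_of_continuousOn hφ.isOpen (continuous_fderiv_apply hF hψ)
      (tsupport_fderiv_apply_subset.trans hs)
      (hφ.continuousOn_step ε)).integrable_of_hasCompactSupport hc1
  · refine Continuous.integrable_of_hasCompactSupport ?_ hc2
    simp_rw [mul_assoc (ψ _)]
    exact continuous_mul_of_continuousOn hφ.isOpen hψ.continuous hs
      ((hφ.continuousOn_deriv_step ε).mul (hφ.continuousOn_fderiv.clm_apply hF.continuousOn))

/-- On the support of `ψ` the cutoffs `step (-φ / ε)` converge to the indicator of `{φ < 0}`, which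
is the interior there; dominated convergence applies. -/
theorem tendsto_integral_step_mul_fderiv (hφ : IsDefiningFunction Ω U φ) (hF : Continuous F)
    (hψ : ContDiff ℝ 1 ψ) (hc : HasCompactSupport ψ) (hs : tsupport ψ ⊆ U) :
    Tendsto (fun ε : ℝ => ∫ x, fderiv ℝ ψ x (F x) * step (ε⁻¹ * -φ x)) (𝓝[>] 0)
      (𝓝 (∫ x in interior Ω, fderiv ℝ ψ x (F x))) := by
  rw [← integral_indicator isOpen_interior.measurableSet]
  refine tendsto_integral_filter_of_dominated_convergence (fun x => ‖fderiv ℝ ψ x (F x)‖)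
    (Eventually.of_forall fun ε => ?_) (Eventually.of_forall fun ε => ae_of_all _ fun x => ?_)
    (integrable_fderiv_apply hF hψ hc).norm (ae_of_all _ fun x => ?_)
  · exact (continuous_mul_of_continuousOn hφ.isOpen (continuous_fderiv_apply hF hψ)
      (tsupport_fderiv_apply_subset.trans hs) (hφ.continuousOn_step ε)).aestronglyMeasurable
  · rw [norm_mul, Real.norm_of_nonneg (step_nonneg _)]
    exact mul_le_of_le_one_right (norm_nonneg _) (step_le_one _)
  · by_cases hx : x ∈ tsupport ψ
    · by_cases hlt : φ x < 0
      · rw [indicator_of_mem ((hφ.mem_interior_iff (hs hx)).2 hlt)]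
        refine tendsto_const_nhds.congr' ?_
        filter_upwards [Ioo_mem_nhdsGT (show 0 < -φ x / 2 by linarith)] with ε hε
        rw [step_of_ge, mul_one]
        rw [le_inv_mul_iff₀ hε.1]
        linarith [hε.2]
      · rw [indicator_of_notMem fun h => hlt ((hφ.mem_interior_iff (hs hx)).1 h)]
        refine tendsto_const_nhds.congr' ?_
        filter_upwards [self_mem_nhdsWithin] with ε hε
        have hε : (0 : ℝ) < ε := hε
        rw [step_of_le, mul_zero]
        have : ε⁻¹ * -φ x ≤ 0 :=
          mul_nonpos_of_nonneg_of_nonpos (inv_pos.2 hε).le (by linarith)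
        linarith
    · have h0 : fderiv ℝ ψ x (F x) = 0 := by rw [fderiv_eq_zero_of_notMem hx]; rfl
      by_cases hi : x ∈ interior Ω <;> simp [hi, h0]

/-- Comparison of the area of the boundary with the volume of thin boundary layers. -/
theorem exists_layer_comparison (hΩ : IsClosed Ω) {K : NNReal}
    (Ψ : OpenPartialHomeomorph R3 R3) (hφ : IsDefiningFunction Ω Ψ.source φ)
    (h0 : ∀ x ∈ Ψ.source, Ψ x 0 = φ x) (hl : LipschitzOnWith K Ψ Ψ.source)
    (ha : ∀ x ∈ Ψ.source, ∀ y ∈ Ψ.source, dist x y ≤ K * dist (Ψ x) (Ψ y))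
    (hψ : Continuous ψ) (hc : HasCompactSupport ψ) (hs : tsupport ψ ⊆ Ψ.source)
    (hpos : ∀ x, 0 ≤ ψ x) : ∃ (m : ℝ → ℝ) (M : ℝ), Tendsto m (𝓝[>] 0) (𝓝 M) ∧
      (∀ ε > 0, ∫ x, ψ x * (ε⁻¹ * deriv step (ε⁻¹ * -φ x)) ≤ K ^ 3 * m ε ∧
        m ε ≤ K ^ 3 * ∫ x, ψ x * (ε⁻¹ * deriv step (ε⁻¹ * -φ x))) ∧
      ∫ x in frontier Ω, ψ x ∂μHE[2] ≤ K ^ 2 * M ∧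
      M ≤ K ^ 2 * ∫ x in frontier Ω, ψ x ∂μHE[2] := by
  obtain ⟨G, hG, hGc, hGΨ, hGout, hGval⟩ := exists_pushforward Ψ hψ hc hs
  have hG0 : ∀ y, 0 ≤ G y := fun y => by
    obtain ⟨x, hx | hx⟩ := hGval y
    · rw [hx]; exact hpos x
    · rw [hx]
  have hψout : ∀ x ∉ Ψ.source, ψ x = 0 := fun x hx =>
    image_eq_zero_of_notMem_tsupport fun h => hx (hs h)
  have hsource := Ψ.open_source.measurableSet
  have htarget := Ψ.open_target.measurableSet
  -- `m ε` and `M` are the layer integral and the plane integral of `ψ` read in the chart, so that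
  -- `m ε → M` is the half-space statement. The exponents `3` and `2` are the dimensions of layer
  -- and surface.
  refine ⟨fun ε => ∫ y, G y * (ε⁻¹ * deriv step (ε⁻¹ * -(y 0))),
    ∫ y in {y : R3 | y 0 = 0}, G y ∂μHE[2], tendsto_integral_mul_deriv_step hG hGc,
    fun ε hε => ?_, ?_⟩
  · have hcont : Continuous fun y : R3 => G y * (ε⁻¹ * deriv step (ε⁻¹ * -(y 0))) := by
      have := continuous_deriv_step
      fun_prop
    have hi : Integrable fun y : R3 => G y * (ε⁻¹ * deriv step (ε⁻¹ * -(y 0))) :=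
      hcont.integrable_of_hasCompactSupport hGc.mul_right
    have key := integral_biLipschitz_le hsource Ψ.image_source_eq_target hl ha 3
      (G := fun y : R3 => G y * (ε⁻¹ * deriv step (ε⁻¹ * -(y 0))))
      (fun y => mul_nonneg (hG0 y) (mul_nonneg (inv_pos.2 hε).le (deriv_step_nonneg _)))
      (by rw [EuclideanSpace.euclideanHausdorffMeasure_eq_volume]; exact hi.integrableOn)
    rw [EuclideanSpace.euclideanHausdorffMeasure_eq_volume] at key
    have e1 : ∫ y in Ψ.target, G y * (ε⁻¹ * deriv step (ε⁻¹ * -(y 0))) =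
        ∫ y, G y * (ε⁻¹ * deriv step (ε⁻¹ * -(y 0))) :=
      setIntegral_eq_integral_of_forall_compl_eq_zero fun y hy => by rw [hGout y hy, zero_mul]
    have e2 : ∫ x in Ψ.source, G (Ψ x) * (ε⁻¹ * deriv step (ε⁻¹ * -(Ψ x 0))) =
        ∫ x, ψ x * (ε⁻¹ * deriv step (ε⁻¹ * -φ x)) := by
      rw [setIntegral_congr_fun (g := fun x => ψ x * (ε⁻¹ * deriv step (ε⁻¹ * -φ x))) hsource
        fun x hx => by simp only [hGΨ x hx, h0 x hx]]
      exact setIntegral_eq_integral_of_forall_compl_eq_zero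
        fun x hx => by rw [hψout x hx, zero_mul]
    rwa [e1, e2] at key
  · have himg : Ψ '' (frontier Ω ∩ Ψ.source) = {y : R3 | y 0 = 0} ∩ Ψ.target := by
      ext y
      constructor
      · rintro ⟨x, ⟨hx, hxs⟩, rfl⟩
        exact ⟨(h0 x hxs).trans ((hφ.mem_frontier_iff hΩ hxs).1 hx), Ψ.map_source hxs⟩
      · rintro ⟨hy, hyt⟩
        have hxs := Ψ.map_target hyt
        refine ⟨Ψ.symm y, ⟨(hφ.mem_frontier_iff hΩ hxs).2 ?_, hxs⟩, Ψ.right_inv hyt⟩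
        rw [← h0 _ hxs, Ψ.right_inv hyt]
        exact hy
    have hplane : MeasurableSet {y : R3 | y 0 = 0} :=
      (isClosed_eq (by fun_prop) continuous_const).measurableSet
    have key := integral_biLipschitz_le (isClosed_frontier.measurableSet.inter hsource) himg
      (hl.mono inter_subset_right) (fun x hx y hy => ha x hx.2 y hy.2) 2 hG0
      ((integrableOn_plane hG hGc).mono_set inter_subset_left)
    have e1 : ∫ y in {y : R3 | y 0 = 0} ∩ Ψ.target, G y ∂μHE[2] =
        ∫ y in {y : R3 | y 0 = 0}, G y ∂μHE[2] :=
      (setIntegral_eq_of_subset_of_forall_sdiff_eq_zero hplane inter_subset_left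
        fun y hy => hGout y fun h => hy.2 ⟨hy.1, h⟩).symm
    have e2 : ∫ x in frontier Ω ∩ Ψ.source, G (Ψ x) ∂μHE[2] = ∫ x in frontier Ω, ψ x ∂μHE[2] := by
      rw [setIntegral_congr_fun (g := ψ) (isClosed_frontier.measurableSet.inter hsource)
        fun x hx => hGΨ x hx.2]
      exact (setIntegral_eq_of_subset_of_forall_sdiff_eq_zero isClosed_frontier.measurableSet
        inter_subset_left fun x hx => hψout x fun h => hx.2 ⟨hx.1, h⟩).symm
    rwa [e1, e2] at key

/-- The flux of `F` through a small piece of the boundary is computed, up to a small relative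
error, by the integral of `F` against the gradient of a cutoff function. -/
theorem IsOutwardUnitNormal.exists_flux_estimate {p n : R3} (hn : IsOutwardUnitNormal Ω p n)
    (hΩ : IsClosed Ω) (hF : Continuous F) (hFw : WeaklyDivFree F (interior Ω)) {ε : ℝ}
    (hε : 0 < ε) : ∃ U, IsOpen U ∧ p ∈ U ∧ ∀ ψ : R3 → ℝ, ContDiff ℝ 1 ψ → HasCompactSupport ψ →
      tsupport ψ ⊆ U → (∀ x, 0 ≤ ψ x) →
      |(∫ x in interior Ω, fderiv ℝ ψ x (F x)) -
        inner ℝ n (F p) * ∫ x in frontier Ω, ψ x ∂μHE[2]| ≤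
        ε * ∫ x in frontier Ω, ψ x ∂μHE[2] := by
  set c : ℝ := inner ℝ n (F p) with hcdef
  -- `τ` bounds the relative distortion of area and is chosen so that `|c| τ ≤ ε / 2`. Below, `K ^ 5
  -- < 1 + τ` because a volume distortion `K ^ 3` and an area distortion `K ^ 2` are combined.
  set τ : ℝ := min 1 (ε / (2 * (|c| + 1))) with hτ
  have hτ0 : 0 < τ := lt_min one_pos (by positivity)
  have hτ1 : τ ≤ 1 := min_le_left _ _
  have hcτ : |c| * τ ≤ ε / 2 := by
    have : τ ≤ ε / (2 * (|c| + 1)) := min_le_right _ _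
    rw [le_div_iff₀ (by positivity)] at this
    nlinarith [abs_nonneg c]
  obtain ⟨K, hK1, hK5⟩ : ∃ K : NNReal, 1 < K ∧ (K : ℝ) ^ 5 < 1 + τ := by
    have hcont : Continuous fun K : NNReal => (K : ℝ) ^ 5 := by fun_prop
    have : Filter.NeBot (𝓝[>] (1 : NNReal)) := nhdsGT_neBot 1
    have h1 : ∀ᶠ K : NNReal in 𝓝[>] (1 : NNReal), (K : ℝ) ^ 5 < 1 + τ :=
      ((hcont.tendsto 1).mono_left nhdsWithin_le_nhds).eventually (gt_mem_nhds (by simp [hτ0]))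
    obtain ⟨K, hK, hK'⟩ := (h1.and self_mem_nhdsWithin).exists
    exact ⟨K, hK', hK⟩
  obtain ⟨U₀, φ, hφ₀, hp, h0, hd⟩ := hn.exists_isDefiningFunction
  have hV : IsOpen (U₀ ∩ (fun x => fderiv ℝ φ x (F x)) ⁻¹' Metric.ball c (ε / 4)) :=
    (hφ₀.continuousOn_fderiv.clm_apply hF.continuousOn).isOpen_inter_preimage hφ₀.isOpen
      Metric.isOpen_ball
  have hpV : p ∈ U₀ ∩ (fun x => fderiv ℝ φ x (F x)) ⁻¹' Metric.ball c (ε / 4) := by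
    refine ⟨hp, ?_⟩
    rw [mem_preimage, hd]
    exact Metric.mem_ball_self (by positivity)
  obtain ⟨Ψ, hpΨ, hΨV, hΨ0, hl, ha⟩ := exists_chart (hφ₀.mono hV inter_subset_left) hpV
    hn.norm_eq_one hd hK1
  have hφ : IsDefiningFunction Ω Ψ.source φ :=
    hφ₀.mono Ψ.open_source (hΨV.trans inter_subset_left)
  refine ⟨Ψ.source, Ψ.open_source, hpΨ, fun ψ hψ hc hs hpos => ?_⟩
  obtain ⟨m, M, hm, hmε, hNM, hMN⟩ := exists_layer_comparison hΩ Ψ hφ hΨ0 hl ha hψ.continuous hc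
    hs hpos
  set N : ℝ := ∫ x in frontier Ω, ψ x ∂μHE[2]
  have hN0 : 0 ≤ N := integral_nonneg hpos
  set k : ℝ := (K : ℝ)
  have hk1 : 1 < k := by exact_mod_cast hK1
  -- The first error is the oscillation of `dφ(F)` about `c`, at most `ε / 4` on the chart; the
  -- second is the discrepancy between the layer integral of `ψ` and its surface integral `N`.
  have hbound : ∀ e : ℝ, 0 < e →
      |(∫ x, fderiv ℝ ψ x (F x) * step (e⁻¹ * -φ x)) - c * N| ≤
        ε / 4 * (k ^ 3 * m e) + |c| * max (k ^ 3 * m e - N) (N - (k ^ 3)⁻¹ * m e) := fun e he => by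
    obtain ⟨h1, h2⟩ := hmε e he
    rw [integral_step_mul_fderiv hφ hF hFw hψ hc hs he]
    set w : R3 → ℝ := fun x => ψ x * (e⁻¹ * deriv step (e⁻¹ * -φ x)) with hw
    have hw0 : ∀ x, 0 ≤ w x := fun x =>
      mul_nonneg (hpos x) (mul_nonneg (inv_pos.2 he).le (deriv_step_nonneg _))
    have hws : tsupport w ⊆ Ψ.source := tsupport_mul_subset_left.trans hs
    have hwc : Continuous w :=
      continuous_mul_of_continuousOn hφ.isOpen hψ.continuous hs (hφ.continuousOn_deriv_step e)
    have hwsupp : HasCompactSupport w := hc.mul_right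
    have hwi : Integrable w := hwc.integrable_of_hasCompactSupport hwsupp
    have hwf : Integrable fun x => w x * fderiv ℝ φ x (F x) :=
      (continuous_mul_of_continuousOn hφ.isOpen hwc hws
        (hφ.continuousOn_fderiv.clm_apply hF.continuousOn)).integrable_of_hasCompactSupport
        hwsupp.mul_right
    have hdiff : |(∫ x, w x * fderiv ℝ φ x (F x)) - c * ∫ x, w x| ≤ ε / 4 * ∫ x, w x := by
      rw [← integral_const_mul, ← integral_const_mul, ← integral_sub hwf (hwi.const_mul c),
        ← Real.norm_eq_abs]
      refine norm_integral_le_of_norm_le (hwi.const_mul _) (ae_of_all _ fun x => ?_)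
      by_cases hx : x ∈ Ψ.source
      · have h3 : |fderiv ℝ φ x (F x) - c| < ε / 4 := (hΨV hx).2
        rw [Real.norm_eq_abs, show w x * fderiv ℝ φ x (F x) - c * w x =
          (fderiv ℝ φ x (F x) - c) * w x by ring, abs_mul, abs_of_nonneg (hw0 x)]
        exact mul_le_mul_of_nonneg_right h3.le (hw0 x)
      · rw [image_eq_zero_of_notMem_tsupport fun h => hx (hws h)]
        simp
    have hmax : |(∫ x, w x) - N| ≤ max (k ^ 3 * m e - N) (N - (k ^ 3)⁻¹ * m e) := by
      have h3 : (k ^ 3)⁻¹ * m e ≤ ∫ x, w x := by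
        rw [inv_mul_le_iff₀ (by positivity)]; exact h2
      rw [abs_le']
      exact ⟨le_max_of_le_left (by linarith), le_max_of_le_right (by linarith)⟩
    calc |(∫ x, w x * fderiv ℝ φ x (F x)) - c * N|
        = |((∫ x, w x * fderiv ℝ φ x (F x)) - c * ∫ x, w x) + c * ((∫ x, w x) - N)| := by
          congr 1; ring
      _ ≤ ε / 4 * (∫ x, w x) + |c| * |(∫ x, w x) - N| := by
          refine (abs_add_le _ _).trans (add_le_add hdiff (abs_mul _ _).le)
      _ ≤ _ := by gcongr
  have hlim : |(∫ x in interior Ω, fderiv ℝ ψ x (F x)) - c * N| ≤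
      ε / 4 * (k ^ 3 * M) + |c| * max (k ^ 3 * M - N) (N - (k ^ 3)⁻¹ * M) := by
    refine le_of_tendsto_of_tendsto
      ((tendsto_integral_step_mul_fderiv hφ hF hψ hc hs).sub_const (c * N)).abs
      (((hm.const_mul _).const_mul _).add
        ((((hm.const_mul _).sub_const N).max ((hm.const_mul _).const_sub N)).const_mul _)) ?_
    filter_upwards [self_mem_nhdsWithin] with e he using hbound e he
  have hkM : k ^ 3 * M ≤ k ^ 5 * N := by
    calc k ^ 3 * M ≤ k ^ 3 * (k ^ 2 * N) := by gcongr
      _ = k ^ 5 * N := by ring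
  have hkN : k ^ 5 * N ≤ (1 + τ) * N := by gcongr
  have hmax : max (k ^ 3 * M - N) (N - (k ^ 3)⁻¹ * M) ≤ τ * N := by
    refine max_le (by linarith) ?_
    -- This follows from `N ≤ k ^ 2 * M` together with `(1 - τ) k ^ 5 ≤ (1 - τ)(1 + τ) ≤ 1`.
    have h3 : k ^ 3 * (1 - τ) * N ≤ M := by
      refine le_of_mul_le_mul_left (a := k ^ 2) ?_ (by positivity)
      refine le_trans ?_ hNM
      have h4 : (1 - τ) * k ^ 5 ≤ 1 := by
        calc (1 - τ) * k ^ 5 ≤ (1 - τ) * (1 + τ) :=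
            mul_le_mul_of_nonneg_left hK5.le (by linarith)
          _ ≤ 1 := by nlinarith
      calc k ^ 2 * (k ^ 3 * (1 - τ) * N) = (1 - τ) * k ^ 5 * N := by ring
        _ ≤ 1 * N := by gcongr
        _ = N := one_mul N
    have h5 : (1 - τ) * N ≤ (k ^ 3)⁻¹ * M := by
      rw [le_inv_mul_iff₀ (by positivity)]; linarith
    linarith
  calc _ ≤ _ := hlim
    _ ≤ ε / 4 * (2 * N) + |c| * (τ * N) :=
      add_le_add (mul_le_mul_of_nonneg_left (by nlinarith) (by positivity))
        (mul_le_mul_of_nonneg_left hmax (abs_nonneg c))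
    _ = ε / 2 * N + |c| * τ * N := by ring
    _ ≤ ε / 2 * N + ε / 2 * N := by gcongr
    _ = ε * N := by ring

end Local

/-! ### Globalization and removal of the singular set -/

section Global

variable {Ω : Set R3} {F : R3 → R3}

theorem measure_singularSet (hΩ : IsRegularDomain Ω) : μHE[2] (singularSet Ω) = 0 := hΩ.ae_normal

theorem isFiniteMeasure_restrict_frontier (hΩ : IsRegularDomain Ω) :
    IsFiniteMeasure ((μHE[2] : Measure R3).restrict (frontier Ω)) :=
  ⟨by simpa using hΩ.area_lt_top⟩

/-- The normal is continuous along the frontier off the closed null set of singular points. -/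
theorem aestronglyMeasurable_outwardNormal (hΩ : IsRegularDomain Ω) :
    AEStronglyMeasurable (outwardNormal Ω) ((μHE[2] : Measure R3).restrict (frontier Ω)) := by
  have hcl := hΩ.isCompact.isClosed
  have hae : (frontier Ω \ singularSet Ω : Set R3) =ᵐ[μHE[2]] frontier Ω :=
    sdiff_null_ae_eq_self (measure_singularSet hΩ)
  rw [← Measure.restrict_congr_set hae]
  refine ContinuousOn.aestronglyMeasurable (fun p hp => ?_)
    (isClosed_frontier.measurableSet.diff (isClosed_singularSet hcl).measurableSet)
  obtain ⟨n, hn⟩ : ∃ n, IsOutwardUnitNormal Ω p n := by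
    by_contra h; exact hp.2 ⟨hp.1, h⟩
  exact (continuousWithinAt_outwardNormal hcl hn).mono sdiff_subset

theorem norm_inner_outwardNormal_le (p : R3) : ‖(inner ℝ (outwardNormal Ω p) (F p) : ℝ)‖ ≤ ‖F p‖ :=
  (norm_inner_le_norm _ _).trans
    (mul_le_of_le_one_left (norm_nonneg _) (norm_outwardNormal_le Ω p))

theorem integrable_mul_flux (hΩ : IsRegularDomain Ω) (hF : Continuous F) {ψ : R3 → ℝ}
    (hψ : Continuous ψ) : Integrable (fun x => ψ x * inner ℝ (outwardNormal Ω x) (F x))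
      ((μHE[2] : Measure R3).restrict (frontier Ω)) := by
  have := isFiniteMeasure_restrict_frontier hΩ
  have hcomp : IsCompact (frontier Ω) :=
    hΩ.isCompact.of_isClosed_subset isClosed_frontier hΩ.isCompact.isClosed.frontier_subset
  have hc : Continuous fun x => ‖ψ x‖ * ‖F x‖ := by fun_prop
  obtain ⟨C, hC⟩ := hcomp.exists_bound_of_continuousOn hc.continuousOn
  refine Integrable.of_bound (C := C) (hψ.aestronglyMeasurable.mul
    ((aestronglyMeasurable_outwardNormal hΩ).inner hF.aestronglyMeasurable)) ?_
  refine ae_restrict_of_forall_mem isClosed_frontier.measurableSet fun x hx => ?_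
  refine le_trans ?_ ((Real.norm_eq_abs _).symm ▸ (le_abs_self _).trans (hC x hx))
  rw [norm_mul]
  exact mul_le_mul_of_nonneg_left (norm_inner_outwardNormal_le x) (norm_nonneg _)

theorem integrable_frontier (hΩ : IsRegularDomain Ω) {ψ : R3 → ℝ} (hψ : Continuous ψ) :
    Integrable ψ ((μHE[2] : Measure R3).restrict (frontier Ω)) := by
  have := isFiniteMeasure_restrict_frontier hΩ
  have hcomp : IsCompact (frontier Ω) :=
    hΩ.isCompact.of_isClosed_subset isClosed_frontier hΩ.isCompact.isClosed.frontier_subset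
  obtain ⟨C, hC⟩ := hcomp.exists_bound_of_continuousOn hψ.continuousOn
  exact Integrable.of_bound hψ.aestronglyMeasurable C
    (ae_restrict_of_forall_mem isClosed_frontier.measurableSet hC)

/-- At points off the frontier both sides vanish for small supports. At a regular boundary point,
continuity of the normal lets the frozen value `⟨n, F p⟩` be replaced by the actual flux density at
the cost of another `ε / 2`. -/
theorem exists_flux_estimate_nhd (hΩ : IsRegularDomain Ω) (hF : Continuous F)
    (hFw : WeaklyDivFree F (interior Ω)) {p : R3} (hp : p ∉ singularSet Ω) {ε : ℝ} (hε : 0 < ε) :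
    ∃ U, IsOpen U ∧ p ∈ U ∧ ∀ ψ : R3 → ℝ, ContDiff ℝ 1 ψ → HasCompactSupport ψ →
      tsupport ψ ⊆ U → (∀ x, 0 ≤ ψ x) →
      |(∫ x in interior Ω, fderiv ℝ ψ x (F x)) -
        ∫ x in frontier Ω, ψ x * inner ℝ (outwardNormal Ω x) (F x) ∂μHE[2]| ≤
        ε * ∫ x in frontier Ω, ψ x ∂μHE[2] := by
  have hcl := hΩ.isCompact.isClosed
  have hzero : ∀ U : Set R3, Disjoint U (frontier Ω) → ∀ ψ : R3 → ℝ, tsupport ψ ⊆ U →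
      (∫ x in frontier Ω, ψ x * inner ℝ (outwardNormal Ω x) (F x) ∂μHE[2] = 0) ∧
      ∫ x in frontier Ω, ψ x ∂μHE[2] = 0 := fun U hU ψ hs => by
    have h0 : ∀ x ∈ frontier Ω, ψ x = 0 := fun x hx =>
      image_eq_zero_of_notMem_tsupport fun h => hU.le_bot ⟨hs h, hx⟩
    exact ⟨setIntegral_eq_zero_of_forall_eq_zero fun x hx => by rw [h0 x hx, zero_mul],
      setIntegral_eq_zero_of_forall_eq_zero h0⟩
  by_cases hpΩ : p ∈ Ω
  swap
  · refine ⟨Ωᶜ, hcl.isOpen_compl, hpΩ, fun ψ _ _ hs _ => ?_⟩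
    obtain ⟨h1, h2⟩ := hzero _ (disjoint_compl_left.mono_right hcl.frontier_subset) ψ hs
    rw [h1, h2, setIntegral_eq_zero_of_forall_eq_zero]
    · simp
    · intro x hx
      rw [fderiv_eq_zero_of_notMem fun h => hs h (interior_subset hx)]; rfl
  by_cases hpi : p ∈ interior Ω
  · refine ⟨interior Ω, isOpen_interior, hpi, fun ψ hψ hc hs _ => ?_⟩
    obtain ⟨h1, h2⟩ := hzero _ disjoint_interior_frontier ψ hs
    rw [h1, h2, setIntegral_eq_integral_of_forall_compl_eq_zero, hFw ψ hψ hc hs]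
    · simp
    · intro x hx
      rw [fderiv_eq_zero_of_notMem fun h => hx (hs h)]; rfl
  have hpf : p ∈ frontier Ω := by rw [hcl.frontier_eq]; exact ⟨hpΩ, hpi⟩
  obtain ⟨n, hn⟩ : ∃ n, IsOutwardUnitNormal Ω p n := by
    by_contra h; exact hp ⟨hpf, h⟩
  obtain ⟨U, hU, hpU, hest⟩ := hn.exists_flux_estimate hcl hF hFw (half_pos hε)
  have hcw : ContinuousWithinAt (fun x => (inner ℝ (outwardNormal Ω x) (F x) : ℝ)) (frontier Ω) p :=
    ContinuousWithinAt.inner (continuousWithinAt_outwardNormal hcl hn) hF.continuousWithinAt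
  have hev := hcw (Metric.ball_mem_nhds _ (half_pos hε))
  obtain ⟨V, hV, hpV, hVb⟩ := mem_nhdsWithin.1 hev
  refine ⟨U ∩ V, hU.inter hV, ⟨hpU, hpV⟩, fun ψ hψ hc hs hpos => ?_⟩
  have h1 := hest ψ hψ hc (hs.trans inter_subset_left) hpos
  have hi := integrable_frontier hΩ hψ.continuous
  have h2 : |(∫ x in frontier Ω, ψ x * inner ℝ (outwardNormal Ω x) (F x) ∂μHE[2]) -
      inner ℝ n (F p) * ∫ x in frontier Ω, ψ x ∂μHE[2]| ≤
      ε / 2 * ∫ x in frontier Ω, ψ x ∂μHE[2] := by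
    rw [← integral_const_mul, ← integral_const_mul,
      ← integral_sub (integrable_mul_flux hΩ hF hψ.continuous) (hi.const_mul _),
      ← Real.norm_eq_abs]
    refine norm_integral_le_of_norm_le (hi.const_mul _)
      (ae_restrict_of_forall_mem isClosed_frontier.measurableSet fun x hx => ?_)
    by_cases hxs : x ∈ tsupport ψ
    · have h3 := hVb ⟨(hs hxs).2, hx⟩
      simp only [mem_preimage, Metric.mem_ball, Real.dist_eq, hn.outwardNormal_eq] at h3
      rw [Real.norm_eq_abs, mul_comm (ψ x), ← sub_mul, abs_mul, abs_of_nonneg (hpos x)]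
      exact mul_le_mul_of_nonneg_right h3.le (hpos x)
    · simp [image_eq_zero_of_notMem_tsupport hxs]
  rw [abs_le] at h1 h2 ⊢
  constructor <;> linarith [h1.1, h1.2, h2.1, h2.2]

/-- The divergence theorem for test functions supported away from the singular part of the
boundary. -/
theorem integral_fderiv_eq_flux (hΩ : IsRegularDomain Ω) (hF : Continuous F)
    (hFw : WeaklyDivFree F (interior Ω)) {χ : R3 → ℝ} (hχ : ContDiff ℝ 1 χ)
    (hc : HasCompactSupport χ) (hpos : ∀ x, 0 ≤ χ x) (hs : Disjoint (tsupport χ) (singularSet Ω)) :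
    ∫ x in interior Ω, fderiv ℝ χ x (F x) =
      ∫ x in frontier Ω, χ x * inner ℝ (outwardNormal Ω x) (F x) ∂μHE[2] := by
  classical
  -- The local errors are `ε` times the surface integrals of the pieces, so they add up to `ε ∫ χ`
  -- however many pieces the partition of unity has.
  have main : ∀ ε : ℝ, 0 < ε → |(∫ x in interior Ω, fderiv ℝ χ x (F x)) -
      ∫ x in frontier Ω, χ x * inner ℝ (outwardNormal Ω x) (F x) ∂μHE[2]| ≤
      ε * ∫ x in frontier Ω, χ x ∂μHE[2] := fun ε hε => by
    choose U hU hpU hest using fun p : tsupport χ =>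
      exists_flux_estimate_nhd hΩ hF hFw (fun h => hs.le_bot ⟨p.2, h⟩ : p.1 ∉ singularSet Ω) hε
    obtain ⟨f, hf⟩ := SmoothPartitionOfUnity.exists_isSubordinate (modelWithCornersSelf ℝ R3)
      (isClosed_tsupport χ) U hU (fun p hp => mem_iUnion.2 ⟨⟨p, hp⟩, hpU ⟨p, hp⟩⟩)
    have hfin := f.locallyFinite.finite_nonempty_inter_compact hc.isCompact
    let s := hfin.toFinset
    let ψ : tsupport χ → R3 → ℝ := fun i x => χ x * f i x
    have hfC : ∀ i, ContDiff ℝ 1 (f i) := fun i => (f i).contMDiff.contDiff.of_le (by simp)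
    have hψC : ∀ i, ContDiff ℝ 1 (ψ i) := fun i => hχ.mul (hfC i)
    have hψc : ∀ i, HasCompactSupport (ψ i) := fun i => hc.mul_right
    have hψp : ∀ i x, 0 ≤ ψ i x := fun i x => mul_nonneg (hpos x) (f.nonneg i x)
    have hψs : ∀ i, tsupport (ψ i) ⊆ U i := fun i => tsupport_mul_subset_right.trans (hf i)
    have hsum : ∀ x, χ x = ∑ i ∈ s, ψ i x := fun x => by
      by_cases hx : x ∈ tsupport χ
      · have h1 := f.sum_eq_one hx
        rw [finsum_eq_sum_of_support_subset (s := s)] at h1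
        · simp only [ψ]
          rw [← Finset.mul_sum, h1, mul_one]
        · intro i hi
          simp only [s, Finite.coe_toFinset]
          exact ⟨x, hi, hx⟩
      · simp [ψ, image_eq_zero_of_notMem_tsupport hx]
    have hχs : χ = fun x => ∑ i ∈ s, ψ i x := funext hsum
    have e1 : ∫ x in interior Ω, fderiv ℝ χ x (F x) =
        ∑ i ∈ s, ∫ x in interior Ω, fderiv ℝ (ψ i) x (F x) := by
      rw [← integral_finsetSum s fun i _ =>
        (integrable_fderiv_apply hF (hψC i) (hψc i)).integrableOn]
      refine integral_congr_ae (ae_of_all _ fun x => ?_)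
      have h1 : fderiv ℝ χ x = ∑ i ∈ s, fderiv ℝ (ψ i) x := by
        conv_lhs => rw [hχs]
        exact fderiv_fun_sum fun i _ => (hψC i).differentiable one_ne_zero x
      simp [h1]
    have e2 : ∫ x in frontier Ω, χ x * inner ℝ (outwardNormal Ω x) (F x) ∂μHE[2] =
        ∑ i ∈ s, ∫ x in frontier Ω, ψ i x * inner ℝ (outwardNormal Ω x) (F x) ∂μHE[2] := by
      rw [← integral_finsetSum s fun i _ => integrable_mul_flux hΩ hF (hψC i).continuous]
      refine integral_congr_ae (ae_of_all _ fun x => ?_)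
      simp only [hsum x, Finset.sum_mul]
    have e3 : ∫ x in frontier Ω, χ x ∂μHE[2] = ∑ i ∈ s, ∫ x in frontier Ω, ψ i x ∂μHE[2] := by
      rw [← integral_finsetSum s fun i _ => integrable_frontier hΩ (hψC i).continuous]
      exact integral_congr_ae (ae_of_all _ hsum)
    rw [e1, e2, e3, ← Finset.sum_sub_distrib, Finset.mul_sum]
    exact (Finset.abs_sum_le_sum_abs _ _).trans (Finset.sum_le_sum fun i _ =>
      hest i (ψ i) (hψC i) (hψc i) (hψs i) (hψp i))
  have hlim : Tendsto (fun ε : ℝ => ε * ∫ x in frontier Ω, χ x ∂μHE[2]) (𝓝[>] 0) (𝓝 0) := by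
    have : Continuous fun ε : ℝ => ε * ∫ x in frontier Ω, χ x ∂μHE[2] := by fun_prop
    simpa using (this.tendsto 0).mono_left nhdsWithin_le_nhds
  have h0 := ge_of_tendsto hlim (by filter_upwards [self_mem_nhdsWithin] with ε hε using main ε hε)
  exact sub_eq_zero.1 (abs_nonpos_iff.1 h0)

/-- The flux of a continuous, weakly divergence free vector field through the boundary of a
regular domain vanishes. -/
theorem integral_flux_eq_zero (hΩ : IsRegularDomain Ω) (hF : Continuous F)
    (hFw : WeaklyDivFree F (interior Ω)) :
    ∫ x in frontier Ω, inner ℝ (outwardNormal Ω x) (F x) ∂μHE[2] = 0 := by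
  have := isFiniteMeasure_restrict_frontier hΩ
  have hcl := hΩ.isCompact.isClosed
  have hfΩ := hcl.frontier_subset
  set μ := (μHE[2] : Measure R3).restrict (frontier Ω)
  have hEc : IsCompact (singularSet Ω) :=
    hΩ.isCompact.of_isClosed_subset (isClosed_singularSet hcl) fun x hx => hfΩ hx.1
  obtain ⟨C₀, hC₀⟩ := hΩ.isCompact.exists_bound_of_continuousOn hF.continuousOn
  set C := max C₀ 0
  have hC0 : 0 ≤ C := le_max_right _ _
  have hC : ∀ x ∈ Ω, ‖F x‖ ≤ C := fun x hx => (hC₀ x hx).trans (le_max_left _ _)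
  obtain ⟨R, hR⟩ := hΩ.isCompact.isBounded.subset_ball (0 : R3)
  have hR0 : (0 : ℝ) < max R 1 := lt_max_of_lt_right one_pos
  let ρ : ContDiffBump (0 : R3) := ⟨max R 1, 2 * max R 1, hR0, by linarith⟩
  have hρ : ∀ x ∈ Ω, ρ x = 1 := fun x hx => ρ.one_of_mem_closedBall
    (Metric.ball_subset_closedBall (Metric.ball_subset_ball (le_max_left _ _) (hR hx)))
  -- One `ε C` comes from the gradient of the cutoff, the other from the part of the frontier in a
  -- neighbourhood `W` of the singular set with area below `ε`.
  have main : ∀ ε : ℝ, 0 < ε → |∫ x, inner ℝ (outwardNormal Ω x) (F x) ∂μ| ≤ ε * (2 * C) :=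
      fun ε hε => by
    have hμE : μ (singularSet Ω) < ENNReal.ofReal ε := by
      rw [show μ (singularSet Ω) = 0 from
        le_antisymm ((Measure.restrict_apply_le _ _).trans_eq (measure_singularSet hΩ)) bot_le]
      simpa using hε
    obtain ⟨W, hEW, hW, hμW⟩ := (singularSet Ω).exists_isOpen_lt_of_lt _ hμE
    obtain ⟨χ, hχ, h01, hχ1, hχ0, hχi, hχε⟩ :=
      exists_cutoff hEc (measure_singularSet hΩ) hW hEW hε
    -- The factor `ρ` equals `1` on `Ω` and serves only to make the support compact.
    let ψ : R3 → ℝ := fun x => (1 - χ x) * ρ x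
    have hψC : ContDiff ℝ 1 ψ := (contDiff_const.sub hχ).mul ρ.contDiff
    have hψs : Disjoint (tsupport ψ) (singularSet Ω) := by
      rw [disjoint_right]
      intro x hx
      rw [notMem_tsupport_iff_eventuallyEq]
      filter_upwards [hχ1 x hx] with y hy
      simp [ψ, hy]
    have hgg := integral_fderiv_eq_flux hΩ hF hFw hψC ρ.hasCompactSupport.mul_left
      (fun x => mul_nonneg (by linarith [(h01 x).2]) ρ.nonneg) hψs
    have e1 : ∫ x in frontier Ω, ψ x * inner ℝ (outwardNormal Ω x) (F x) ∂μHE[2] =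
        (∫ x, inner ℝ (outwardNormal Ω x) (F x) ∂μ) -
          ∫ x, χ x * inner ℝ (outwardNormal Ω x) (F x) ∂μ := by
      have hi1 := integrable_mul_flux hΩ hF (ψ := fun _ => 1) continuous_const
      simp only [one_mul] at hi1
      rw [← integral_sub hi1 (integrable_mul_flux hΩ hF hχ.continuous)]
      refine setIntegral_congr_fun isClosed_frontier.measurableSet fun x hx => ?_
      simp only [ψ, hρ x (hfΩ hx)]
      ring
    have b1 : |∫ x in interior Ω, fderiv ℝ ψ x (F x)| ≤ ε * C := by
      have hfd : ∀ x ∈ interior Ω, ‖fderiv ℝ ψ x (F x)‖ ≤ ‖fderiv ℝ χ x‖ * C := fun x hx => by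
        have hev : ψ =ᶠ[𝓝 x] fun y => 1 - χ y := by
          filter_upwards [isOpen_interior.mem_nhds hx] with y hy
          simp [ψ, hρ y (interior_subset hy)]
        rw [hev.fderiv_eq, fderiv_const_sub, neg_apply, norm_neg]
        exact (ContinuousLinearMap.le_opNorm _ _).trans (mul_le_mul_of_nonneg_left
          (hC x (interior_subset hx)) (norm_nonneg _))
      calc _ ≤ ∫ x in interior Ω, ‖fderiv ℝ χ x‖ * C :=
            norm_integral_le_of_norm_le (hχi.mul_const C).integrableOn
              (ae_restrict_of_forall_mem isOpen_interior.measurableSet hfd)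
        _ = (∫ x in interior Ω, ‖fderiv ℝ χ x‖) * C := integral_mul_const _ _
        _ ≤ (∫ x, ‖fderiv ℝ χ x‖) * C :=
            mul_le_mul_of_nonneg_right
              (setIntegral_le_integral hχi (ae_of_all _ fun x => norm_nonneg _)) hC0
        _ ≤ ε * C := by gcongr
    have b2 : |∫ x, χ x * inner ℝ (outwardNormal Ω x) (F x) ∂μ| ≤ ε * C := by
      have hb : ∀ x ∈ frontier Ω, ‖χ x * inner ℝ (outwardNormal Ω x) (F x)‖ ≤
          W.indicator (fun _ => C) x := fun x hx => by
        by_cases hxW : x ∈ W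
        · rw [indicator_of_mem hxW, norm_mul, Real.norm_of_nonneg (h01 x).1]
          exact (mul_le_of_le_one_left (norm_nonneg _) (h01 x).2).trans
            ((norm_inner_outwardNormal_le x).trans (hC x (hfΩ hx)))
        · simp [hχ0 x hxW, hxW]
      calc _ ≤ ∫ x, W.indicator (fun _ => C) x ∂μ :=
            norm_integral_le_of_norm_le ((integrable_const C).indicator hW.measurableSet)
              (ae_restrict_of_forall_mem isClosed_frontier.measurableSet hb)
        _ = μ.real W * C := by
            rw [integral_indicator hW.measurableSet, setIntegral_const, smul_eq_mul]
        _ ≤ ε * C := by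
            gcongr
            exact ENNReal.toReal_le_of_le_ofReal hε.le hμW.le
    rw [e1] at hgg
    rw [hgg] at b1
    rw [abs_le] at b1 b2 ⊢
    constructor <;> linarith [b1.1, b1.2, b2.1, b2.2]
  have hlim : Tendsto (fun ε : ℝ => ε * (2 * C)) (𝓝[>] 0) (𝓝 0) := by
    have : Continuous fun ε : ℝ => ε * (2 * C) := by fun_prop
    simpa using (this.tendsto 0).mono_left nhdsWithin_le_nhds
  have h0 := ge_of_tendsto hlim (by filter_upwards [self_mem_nhdsWithin] with ε hε using main ε hε)
  exact abs_nonpos_iff.1 h0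

end Global

/-! ### From quaternionic integrands to real fluxes -/

/-- The three units `1, i, j` attached to the coordinate directions. -/
def coordUnit : Fin 3 → ℍ := ![1, qi, qj]

/-- The real vector field whose flux is the real component `ℓ` of `g dσ f`. -/
noncomputable def fluxField (ℓ : ℍ →L[ℝ] ℝ) (g f : R3 → ℍ) (x : R3) : R3 :=
  WithLp.toLp 2 fun m => ℓ (g x * coordUnit m * f x)

theorem continuous_fluxField (ℓ : ℍ →L[ℝ] ℝ) {g f : R3 → ℍ} (hg : Continuous g)
    (hf : Continuous f) : Continuous (fluxField ℓ g f) :=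
  (PiLp.continuous_toLp 2 _).comp (continuous_pi fun m => by fun_prop)

theorem hasFDerivAt_fluxField_apply (ℓ : ℍ →L[ℝ] ℝ) {g f : R3 → ℍ} {x : R3}
    (hg : DifferentiableAt ℝ g x) (hf : DifferentiableAt ℝ f x) (m : Fin 3) :
    ∃ L : R3 →L[ℝ] ℝ, HasFDerivAt (fun y => fluxField ℓ g f y m) L x ∧
      ∀ v, L v = ℓ (g x * coordUnit m * fderiv ℝ f x v + fderiv ℝ g x v * coordUnit m * f x) := by
  have h1 := (hg.hasFDerivAt.mul_const' (coordUnit m)).mul' hf.hasFDerivAt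
  refine ⟨_, ℓ.hasFDerivAt.comp x h1, fun v => ?_⟩
  simp

theorem differentiableAt_fluxField (ℓ : ℍ →L[ℝ] ℝ) {g f : R3 → ℍ} {x : R3}
    (hg : DifferentiableAt ℝ g x) (hf : DifferentiableAt ℝ f x) :
    DifferentiableAt ℝ (fluxField ℓ g f) x :=
  differentiableAt_euclidean.2 fun m =>
    (hasFDerivAt_fluxField_apply ℓ hg hf m).choose_spec.1.differentiableAt

/-- The unit `e_m` stands between `g` and `f`, so in the Leibniz rule it joins `∂f` from the left
and `∂g` from the right; this is why `g` must be right-monogenic and `f` left-monogenic. -/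
theorem div_fluxField (ℓ : ℍ →L[ℝ] ℝ) {g f : R3 → ℍ} {x : R3}
    (hg : DifferentiableAt ℝ g x) (hf : DifferentiableAt ℝ f x) :
    ∑ m, (fderiv ℝ (fluxField ℓ g f) x (EuclideanSpace.single m 1)) m =
      ℓ (g x * leftD f x + rightD g x * f x) := by
  have hm : ∀ m, (fderiv ℝ (fluxField ℓ g f) x (EuclideanSpace.single m 1)) m =
      ℓ (g x * coordUnit m * partialDeriv m f x + partialDeriv m g x * coordUnit m * f x) := by
    intro m
    obtain ⟨L, hL, hLv⟩ := hasFDerivAt_fluxField_apply ℓ hg hf m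
    have h1 := (EuclideanSpace.proj m : R3 →L[ℝ] ℝ).hasFDerivAt.comp x
      (differentiableAt_fluxField ℓ hg hf).hasFDerivAt
    exact (DFunLike.congr_fun (h1.unique hL) _).trans (hLv _)
  simp only [Fin.sum_univ_three, hm, ← map_add]
  congr 1
  simp only [coordUnit, leftD, rightD, Matrix.cons_val_zero, Matrix.cons_val_one, Matrix.cons_val]
  noncomm_ring

theorem inner_fluxField (ℓ : ℍ →L[ℝ] ℝ) (g f : R3 → ℍ) (x n : R3) :
    inner ℝ n (fluxField ℓ g f x) = ℓ (g x * normalQuat n * f x) := by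
  rw [inner_eq]
  simp only [fluxField, coordUnit, normalQuat, Matrix.cons_val_zero, Matrix.cons_val_one,
    Matrix.cons_val, mul_add, add_mul, map_add, mul_smul_comm, smul_mul_assoc, map_smul,
    smul_eq_mul]

theorem continuous_normalQuat : Continuous normalQuat := by
  unfold normalQuat
  fun_prop

theorem dsigmaDensity_ae_eq {Ω : Set R3} (hΩ : IsRegularDomain Ω) :
    ∀ᵐ p ∂(μHE[2] : Measure R3).restrict (frontier Ω),
      p ∈ frontier Ω ∧ dsigmaDensity Ω p = normalQuat (outwardNormal Ω p) := by
  have h1 : ∀ᵐ p ∂(μHE[2] : Measure R3), p ∉ singularSet Ω :=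
    measure_eq_zero_iff_ae_notMem.1 (measure_singularSet hΩ)
  filter_upwards [ae_restrict_of_ae h1, ae_restrict_mem isClosed_frontier.measurableSet] with p hp hpf
  obtain ⟨n, hn⟩ : ∃ n, IsOutwardUnitNormal Ω p n := by
    by_contra h; exact hp ⟨hpf, h⟩
  exact ⟨hpf, by rw [hn.dsigmaDensity_eq, hn.outwardNormal_eq]⟩

theorem integrable_normalQuat {Ω : Set R3} (hΩ : IsRegularDomain Ω) {g f : R3 → ℍ}
    (hg : Continuous g) (hf : Continuous f) :
    Integrable (fun p => g p * normalQuat (outwardNormal Ω p) * f p)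
      ((μHE[2] : Measure R3).restrict (frontier Ω)) := by
  have := isFiniteMeasure_restrict_frontier hΩ
  obtain ⟨C, hC⟩ := ((isCompact_closedBall (0 : R3) 1).prod (hΩ.isCompact)).exists_bound_of_continuousOn
    (f := fun q : R3 × R3 => g q.2 * normalQuat q.1 * f q.2) (by
      have := continuous_normalQuat
      fun_prop)
  refine Integrable.of_bound (C := C) ((hg.aestronglyMeasurable.mul
    (continuous_normalQuat.comp_aestronglyMeasurable
      (aestronglyMeasurable_outwardNormal hΩ))).mul hf.aestronglyMeasurable) ?_
  exact ae_restrict_of_forall_mem isClosed_frontier.measurableSet fun x hx =>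
    hC (outwardNormal Ω x, x) ⟨mem_closedBall_zero_iff.2 (norm_outwardNormal_le Ω x),
      hΩ.isCompact.isClosed.frontier_subset hx⟩

theorem integral_normalQuat_eq_zero {Ω : Set R3} (hΩ : IsRegularDomain Ω) {g f : R3 → ℍ}
    (hg : Continuous g) (hf : Continuous f) (hg' : RightMonogenicOn g (interior Ω))
    (hf' : LeftMonogenicOn f (interior Ω)) :
    ∫ p in frontier Ω, g p * normalQuat (outwardNormal Ω p) * f p ∂μHE[2] = 0 := by
  -- It suffices to treat the real components `⟨a, ·⟩`, each of which is the flux of a real vector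
  -- field.
  refine ext_inner_left ℝ fun a => ?_
  rw [inner_zero_right]
  have hdiff : ∀ x ∈ interior Ω, DifferentiableAt ℝ g x ∧ DifferentiableAt ℝ f x := fun x hx =>
    ⟨(hg'.1 x hx).differentiableAt (isOpen_interior.mem_nhds hx),
      (hf'.1 x hx).differentiableAt (isOpen_interior.mem_nhds hx)⟩
  have hF := continuous_fluxField (innerSL ℝ a) hg hf
  have h0 := integral_flux_eq_zero hΩ hF fun η hη hc hs => integral_fderiv_apply_eq_zero hF
    (fun x hx => differentiableAt_fluxField _ (hdiff x hx).1 (hdiff x hx).2)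
    (fun x hx => by
      rw [div_fluxField _ (hdiff x hx).1 (hdiff x hx).2, hf'.2 x hx, hg'.2 x hx]
      simp) hη hc hs
  simp_rw [inner_fluxField] at h0
  rw [ContinuousLinearMap.integral_comp_comm _ (integrable_normalQuat hΩ hg hf)] at h0
  exact h0

/-- Tietze's theorem. The flux argument uses globally continuous fields, and neither the boundary
integrand nor the monogenic equations in the interior see values outside `Ω`. -/
theorem exists_continuous_extension {Ω : Set R3} (hΩ : IsClosed Ω) {f : R3 → ℍ}
    (hf : ContinuousOn f Ω) : ∃ f' : R3 → ℍ, Continuous f' ∧ EqOn f' f Ω := by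
  obtain ⟨f', hf'⟩ := ContinuousMap.exists_restrict_eq hΩ ⟨Ω.domRestrict f, hf.domRestrict⟩
  exact ⟨f', f'.continuous, fun x hx => DFunLike.congr_fun hf' ⟨x, hx⟩⟩

theorem partialDeriv_congr {O : Set R3} (hO : IsOpen O) {f f' : R3 → ℍ} (h : EqOn f' f O) (m : Fin 3)
    {x : R3} (hx : x ∈ O) : partialDeriv m f' x = partialDeriv m f x := by
  rw [partialDeriv, (h.eventuallyEq_of_mem (hO.mem_nhds hx)).fderiv_eq, partialDeriv]

/-- Cauchy's integral theorem for monogenic functions on regular domains. -/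
theorem IsRegularDomain.boundaryIntegral_eq_zero {Ω : Set R3} (hΩ : IsRegularDomain Ω)
    {f g : R3 → ℍ} (hf : ContinuousOn f Ω) (hg : ContinuousOn g Ω)
    (hg' : RightMonogenicOn g (interior Ω))
    (hf' : LeftMonogenicOn f (interior Ω)) :
    BoundaryIntegrable Ω g f ∧ boundaryIntegral Ω g f = 0 := by
  have hcl := hΩ.isCompact.isClosed
  obtain ⟨f₁, hf₁, hff⟩ := exists_continuous_extension hcl hf
  obtain ⟨g₁, hg₁, hgg⟩ := exists_continuous_extension hcl hg
  have hae : (fun p => g₁ p * normalQuat (outwardNormal Ω p) * f₁ p)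
      =ᵐ[(μHE[2] : Measure R3).restrict (frontier Ω)] fun p => g p * dsigmaDensity Ω p * f p := by
    filter_upwards [dsigmaDensity_ae_eq hΩ] with p hp
    rw [hp.2, hff (hcl.frontier_subset hp.1), hgg (hcl.frontier_subset hp.1)]
  have hffi := hff.mono interior_subset
  have hggi := hgg.mono interior_subset
  refine ⟨(integrable_normalQuat hΩ hg₁ hf₁).congr hae, ?_⟩
  rw [boundaryIntegral, ← integral_congr_ae hae]
  refine integral_normalQuat_eq_zero hΩ hg₁ hf₁ ⟨hg'.1.congr hggi, fun p hp => ?_⟩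
    ⟨hf'.1.congr hffi, fun p hp => ?_⟩
  · rw [← hg'.2 p hp]
    simp only [rightD, partialDeriv_congr isOpen_interior hggi _ hp]
  · rw [← hf'.2 p hp]
    simp only [leftD, partialDeriv_congr isOpen_interior hffi _ hp]

end QuatCauchy

theorem mainTheorem7 (Ω : Set QuatCauchy.R3) (hΩ : QuatCauchy.IsRegularDomain Ω)
    (f g : QuatCauchy.R3 → ℍ) (hf : ContinuousOn f Ω) (hg : ContinuousOn g Ω)
    (hg' : QuatCauchy.RightMonogenicOn g (interior Ω))
    (hf' : QuatCauchy.LeftMonogenicOn f (interior Ω)) :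
    QuatCauchy.BoundaryIntegrable Ω g f ∧ QuatCauchy.boundaryIntegral Ω g f = 0 :=
  hΩ.boundaryIntegral_eq_zero hf hg hg' hf'
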